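/- **Proposition.** Let $G$ be a compact Lie group with Lie algebra $\mathfrak g$, let $H\subset G$ be a closed subgroup with Lie algebra $\mathfrak h$, and let $M=G/H$. Fix an $\mathrm{Ad}(G)$-invariant Euclidean inner product $Q$ on $\mathfrak g$. Let $\mathfrak k$ be a *toral $H$-subalgebra* of $\mathfrak g$, i.e. an $\mathrm{Ad}(H)$-invariant Lie subalgebra with $\mathfrak h\subsetneq\mathfrak k\subsetneq\mathfrak g$ and $[\mathfrak k,\mathfrak k]\subset\mathfrak h$. Let $K$ be the subgroup of $G$ generated by $H$ and the connected Lie subgroup with Lie algebra $\mathfrak k$, and let $N=G/K$ (only a local quotient if $K$ is not closed). Let $\mathfrak m=\mathfrak h^{\perp}$, $\mathfrak n=\mathfrak k^{\perp}$ and $\mathfrak t=\mathfrak k\cap\mathfrak h^\perp$ (orthogonal complements with respect to $Q$), so that $\mathfrak m=\mathfrak t\oplus\mathfrak n$, $\mathfrak m\simeq T_{eH}M$, $\mathfrak n\simeq T_{eK}N$. A $G$-invariant Riemannian metric on $M$ is identified with the $Q$-symmetric, positive definite, $\mathrm{Ad}(H)$-invariant endomorphism $P$ of $\mathfrak m$ for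 which the metric is $Q(P\,\cdot,\cdot)$; a $G$-invariant metric on $N$ is identified in the same way with an $\mathrm{Ad}(K)$-invariant endomorphism of $\mathfrak n$. The scalar curvature $\mathrm{scal}_M(P)$ is given by $$-2Q(S(P)(V_1)V_2,V_3)=Q([V_1,V_2]_{\mathfrak m},V_3)+Q([P^{-1}V_3,V_1]_{\mathfrak m},PV_2)+Q([P^{-1}V_3,V_2]_{\mathfrak m},PV_1),$$ $$\mathrm{Rm}(P)(V_1,V_2)=\mathrm{ad}([V_1,V_2]_{\mathfrak h})-[S(P)(V_1),S(P)(V_2)]-S(P)([V_1,V_2]_{\mathfrak m}),$$ $$Q(\mathrm{Ric}(P)V_1,V_2)=\mathrm{Tr}\big(V\mapsto\mathrm{Rm}(P)(V_1,V)V_2\big),\qquad \mathrm{scal}_M(P)=\mathrm{Tr}\big(P^{-1}\mathrm{Ric}(P)\big)$$ for $V_1,V_2,V_3\in\mathfrak m$, where subscripts denote $Q$-orthogonal projections; $\mathrm{scal}_N$ is given by the same formulas with $(\mathfrak h,\mathfrak m)$ replaced by $(\mathfrak k,\mathfrak n)$. A *$\mathfrak k$-submersion metric* is a $G$-invariant metric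 $P$ on $M$ that preserves the decomposition $\mathfrak m=\mathfrak t\oplus\mathfrak n$ and whose restriction to $\mathfrak n$ is $\mathrm{Ad}(K)$-invariant; write $P=P_{\mathfrak t}\oplus P_{\mathfrak n}$. Let $(P^{(n)})_{n\in\mathbb N}$ be a sequence of $\mathfrak k$-submersion metrics, $P^{(n)}=P^{(n)}_{\mathfrak t}\oplus P^{(n)}_{\mathfrak n}$, such that $P^{(n)}_{\mathfrak t}\to 0$ and $P^{(n)}_{\mathfrak n}\to P^{(\infty)}_{\mathfrak n}$ as $n\to\infty$, where $P^{(\infty)}_{\mathfrak n}$ is a $G$-invariant Riemannian metric on $N$ (in particular positive definite). Then $$\mathrm{scal}_M(P^{(n)})\longrightarrow \mathrm{scal}_N(P^{(\infty)}_{\mathfrak n})\qquad\text{as } n\to\infty .$$ -/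

import Mathlib

open Filter Topology
open scoped Manifold ContDiff

noncomputable section

/-! ### Euclidean inner products on a finite-dimensional real vector space -/

/-- A Euclidean inner product on a real vector space, given as a bilinear form. -/
structure EuclideanForm (V : Type*) [AddCommGroup V] [Module ℝ V] where
  form : LinearMap.BilinForm ℝ V
  symm : ∀ x y, form x y = form y x
  pos : ∀ x, x ≠ 0 → 0 < form x x

namespace EuclideanForm

variable {V : Type*} [AddCommGroup V] [Module ℝ V] (Q : EuclideanForm V)

theorem nondegenerate : Q.form.Nondegenerate := by
  refine ⟨fun x hx => ?_, fun x hx => ?_⟩ <;>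
  · by_contra h
    exact (Q.pos x h).ne' (hx x)

/-- The restriction of a Euclidean inner product to a subspace. -/
def restrict (W : Submodule ℝ V) : EuclideanForm W where
  form := Q.form.restrict W
  symm x y := Q.symm x y
  pos x hx := Q.pos x (by simpa using hx)

/-- The `Q`-orthogonal complement of a subspace. -/
abbrev perp (W : Submodule ℝ V) : Submodule ℝ V := Q.form.orthogonal W

variable [FiniteDimensional ℝ V]

theorem isCompl_perp (W : Submodule ℝ V) : IsCompl W (Q.perp W) :=
  LinearMap.BilinForm.isCompl_orthogonal_of_restrict_nondegenerate
    (fun x y h => by rw [Q.symm]; exact h) (Q.restrict W).nondegenerate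

/-- The `Q`-orthogonal projection onto a subspace. -/
def proj (W : Submodule ℝ V) : V →ₗ[ℝ] W :=
  W.projectionOnto (Q.perp W) (Q.isCompl_perp W)

/-- The vector representing a linear functional with respect to `Q`. -/
def riesz : Module.Dual ℝ V →ₗ[ℝ] V :=
  (Q.form.toDual Q.nondegenerate).symm.toLinearMap

theorem form_riesz (f : Module.Dual ℝ V) (x : V) : Q.form (Q.riesz f) x = f x := by
  simp [riesz]

/-- The endomorphism `π_U ∘ P|_U` of `U` induced by an endomorphism `P` of `W`; it is the restriction
of `P` to `U` if `U ≤ W` and `P` maps `U` to itself. -/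
def restrictEnd (W U : Submodule ℝ V) (P : Module.End ℝ W) : Module.End ℝ U :=
  Q.proj U ∘ₗ W.subtype ∘ₗ P ∘ₗ Q.proj W ∘ₗ U.subtype

end EuclideanForm

/-! ### Curvature of an invariant metric on a homogeneous space

Here `𝔤` is the Lie algebra of the group, `𝔥` the isotropy algebra, `𝔪` the `Q`-orthogonal
complement of `𝔥` (identified with the tangent space at the origin), and `P` the endomorphism of `𝔪`
that represents the metric `Q(P ·, ·)`. -/

namespace HomogeneousMetric

variable {𝔤 : Type*} [LieRing 𝔤] [LieAlgebra ℝ 𝔤] [FiniteDimensional ℝ 𝔤]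
  (Q : EuclideanForm 𝔤) (𝔥 : LieSubalgebra ℝ 𝔤)

/-- The reductive complement `𝔪 = 𝔥^⊥`. -/
abbrev compl : Submodule ℝ 𝔤 := Q.perp 𝔥.toSubmodule

/-- `[X, Y]_𝔪`, the `𝔪`-component of the bracket of `X, Y ∈ 𝔪`. -/
def bracketM : compl Q 𝔥 →ₗ[ℝ] compl Q 𝔥 →ₗ[ℝ] compl Q 𝔥 :=
  LinearMap.mk₂ ℝ (fun X Y => Q.proj (compl Q 𝔥) ⁅(X : 𝔤), (Y : 𝔤)⁆)
    (by simp) (by simp) (by simp) (by simp)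

/-- `ad([X, Y]_𝔥)` acting on `𝔪`, for `X, Y ∈ 𝔪`. -/
def adBracketH : compl Q 𝔥 →ₗ[ℝ] compl Q 𝔥 →ₗ[ℝ] Module.End ℝ (compl Q 𝔥) :=
  LinearMap.mk₂ ℝ
    (fun X Y => Q.proj (compl Q 𝔥) ∘ₗ
      (LieAlgebra.ad ℝ 𝔤 (Q.proj 𝔥.toSubmodule ⁅(X : 𝔤), (Y : 𝔤)⁆ : 𝔤) : Module.End ℝ 𝔤) ∘ₗ
      (compl Q 𝔥).subtype)
    (by intros; ext; simp) (by intros; ext; simp)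
    (by intros; ext; simp) (by intros; ext; simp)

variable (P : Module.End ℝ (compl Q 𝔥))

/-- `Q([X, Y]_𝔪, Z) + Q([P⁻¹Z, X]_𝔪, P Y) + Q([P⁻¹Z, Y]_𝔪, P X)`. -/
def sForm (X Y : compl Q 𝔥) : Module.Dual ℝ (compl Q 𝔥) where
  toFun Z :=
    Q.form (bracketM Q 𝔥 X Y) Z
      + Q.form (bracketM Q 𝔥 (Ring.inverse P Z) X) (P Y)
      + Q.form (bracketM Q 𝔥 (Ring.inverse P Z) Y) (P X)
  map_add' Z W := by simp; ring
  map_smul' c Z := by simp; ring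

theorem sForm_add_left (X X' Y : compl Q 𝔥) :
    sForm Q 𝔥 P (X + X') Y = sForm Q 𝔥 P X Y + sForm Q 𝔥 P X' Y :=
  LinearMap.ext fun Z => by simp [sForm]; ring

theorem sForm_smul_left (c : ℝ) (X Y : compl Q 𝔥) :
    sForm Q 𝔥 P (c • X) Y = c • sForm Q 𝔥 P X Y :=
  LinearMap.ext fun Z => by simp [sForm]; ring

theorem sForm_add_right (X Y Y' : compl Q 𝔥) :
    sForm Q 𝔥 P X (Y + Y') = sForm Q 𝔥 P X Y + sForm Q 𝔥 P X Y' :=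
  LinearMap.ext fun Z => by simp [sForm]; ring

theorem sForm_smul_right (c : ℝ) (X Y : compl Q 𝔥) :
    sForm Q 𝔥 P X (c • Y) = c • sForm Q 𝔥 P X Y :=
  LinearMap.ext fun Z => by simp [sForm]; ring

/-- The tensor `S(P) : 𝔪 → End(𝔪)`: minus the Levi-Civita connection of `P`, taken relative to the
canonical connection of `𝔤 = 𝔥 + 𝔪`. It is determined by `form_S`. -/
def S : compl Q 𝔥 →ₗ[ℝ] Module.End ℝ (compl Q 𝔥) :=
  LinearMap.mk₂ ℝ
    (fun X Y => (-(1 / 2 : ℝ)) • (Q.restrict (compl Q 𝔥)).riesz (sForm Q 𝔥 P X Y))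
    (fun X X' Y => by rw [sForm_add_left, map_add, smul_add])
    (fun c X Y => by rw [sForm_smul_left, map_smul, smul_comm])
    (fun X Y Y' => by rw [sForm_add_right, map_add, smul_add])
    (fun c X Y => by rw [sForm_smul_right, map_smul, smul_comm])

theorem form_S (X Y Z : compl Q 𝔥) :
    -2 * Q.form (S Q 𝔥 P X Y) Z =
      Q.form (bracketM Q 𝔥 X Y) Z
        + Q.form (bracketM Q 𝔥 (Ring.inverse P Z) X) (P Y)
        + Q.form (bracketM Q 𝔥 (Ring.inverse P Z) Y) (P X) := by
  have h := (Q.restrict (compl Q 𝔥)).form_riesz (sForm Q 𝔥 P X Y) Z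
  change Q.form ((Q.restrict (compl Q 𝔥)).riesz (sForm Q 𝔥 P X Y) : 𝔤) Z = _ at h
  simp only [S, LinearMap.mk₂_apply, Submodule.coe_smul, map_smul, LinearMap.smul_apply, h]
  simp [sForm]

/-- The curvature tensor `Rm(P)(X, Y) = ad([X, Y]_𝔥) - [S(X), S(Y)] - S([X, Y]_𝔪)`. -/
def Rm : compl Q 𝔥 →ₗ[ℝ] compl Q 𝔥 →ₗ[ℝ] Module.End ℝ (compl Q 𝔥) :=
  LinearMap.mk₂ ℝ
    (fun X Y => adBracketH Q 𝔥 X Y - (S Q 𝔥 P X * S Q 𝔥 P Y - S Q 𝔥 P Y * S Q 𝔥 P X)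
      - S Q 𝔥 P (bracketM Q 𝔥 X Y))
    (by intros; simp [add_mul, mul_add]; abel) (by intros; simp [smul_sub])
    (by intros; simp [add_mul, mul_add]; abel) (by intros; simp [smul_sub])

/-- The Ricci form `(X, Y) ↦ Tr (Z ↦ Rm(P)(X, Z) Y)`. -/
def ricForm : LinearMap.BilinForm ℝ (compl Q 𝔥) :=
  LinearMap.mk₂ ℝ (fun X Y => LinearMap.trace ℝ (compl Q 𝔥) ((Rm Q 𝔥 P X).flip Y))
    (by intro X X' Y; rw [← map_add]; congr 1; ext Z; simp)
    (by intro c X Y; rw [← map_smul]; congr 1; ext Z; simp)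
    (by intro X Y Y'; rw [← map_add]; congr 1; ext Z; simp)
    (by intro c X Y; rw [← map_smul]; congr 1; ext Z; simp)

/-- The endomorphism `Ric(P)` of `𝔪` with `Q(Ric(P) X, Y) = Tr (Z ↦ Rm(P)(X, Z) Y)`. -/
def Ric : Module.End ℝ (compl Q 𝔥) :=
  (Q.restrict (compl Q 𝔥)).riesz ∘ₗ ricForm Q 𝔥 P

theorem form_Ric (X Y : compl Q 𝔥) :
    Q.form (Ric Q 𝔥 P X) Y = LinearMap.trace ℝ (compl Q 𝔥) ((Rm Q 𝔥 P X).flip Y) :=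
  (Q.restrict (compl Q 𝔥)).form_riesz (ricForm Q 𝔥 P X) Y

/-- The scalar curvature `scal(P) = Tr (P⁻¹ Ric(P))`. -/
def scal : ℝ :=
  LinearMap.trace ℝ (compl Q 𝔥) (Ring.inverse P * Ric Q 𝔥 P)

end HomogeneousMetric

/-! ### Lie groups, subgroups and invariant metrics -/

section LieGroup

variable {E : Type*} [NormedAddCommGroup E] [NormedSpace ℝ E] [FiniteDimensional ℝ E]
  {G : Type*} [TopologicalSpace G] [ChartedSpace E G] [Group G]

instance lieGroupThree [LieGroup 𝓘(ℝ, E) ∞ G] : LieGroup 𝓘(ℝ, E) (minSmoothness ℝ 3) G :=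
  LieGroup.of_le (n := ∞) (by rw [minSmoothness_of_isRCLikeNormedField]; exact ENat.LEInfty.out)

instance finiteDimensionalTangentSpace (x : G) :
    FiniteDimensional ℝ (TangentSpace 𝓘(ℝ, E) x) :=
  inferInstanceAs (FiniteDimensional ℝ E)

variable (E) in
/-- The adjoint representation: `Ad(a)` is the derivative of `x ↦ a x a⁻¹` at the identity. -/
def Ad (a : G) : GroupLieAlgebra 𝓘(ℝ, E) G →L[ℝ] GroupLieAlgebra 𝓘(ℝ, E) G :=
  mfderiv 𝓘(ℝ, E) 𝓘(ℝ, E) (fun x : G => a * x * a⁻¹) 1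

/-- `φ` is the one-parameter subgroup `t ↦ exp(tX)`: the integral curve through the identity of the
left-invariant vector field of `X`. -/
def IsExpCurve (X : GroupLieAlgebra 𝓘(ℝ, E) G) (φ : ℝ → G) : Prop :=
  φ 0 = 1 ∧ IsMIntegralCurve φ (mulInvariantVectorField (I := 𝓘(ℝ, E)) X)

variable [LieGroup 𝓘(ℝ, E) ∞ G]

variable (E) in
/-- The Lie algebra of a closed subgroup `H`, generated by all `X` with `exp(tX) ∈ H` for all `t`.
(For a closed subgroup these `X` already form a Lie subalgebra.) -/
def subgroupLieAlgebra (H : Subgroup G) : LieSubalgebra ℝ (GroupLieAlgebra 𝓘(ℝ, E) G) :=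
  LieSubalgebra.lieSpan ℝ _ {X | ∃ φ : ℝ → G, IsExpCurve X φ ∧ ∀ t, φ t ∈ H}

/-- `𝔨` is a toral `H`-subalgebra: an `Ad(H)`-invariant Lie subalgebra that lies properly between
`𝔥 = Lie(H)` and `𝔤`, with `[𝔨, 𝔨] ⊆ 𝔥`. -/
structure IsToralSubalgebra (H : Subgroup G)
    (𝔨 : LieSubalgebra ℝ (GroupLieAlgebra 𝓘(ℝ, E) G)) : Prop where
  lt : subgroupLieAlgebra E H < 𝔨
  lt_top : 𝔨 < ⊤
  ad_mem : ∀ a ∈ H, ∀ X ∈ 𝔨, Ad E a X ∈ 𝔨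
  lie_mem : ∀ X ∈ 𝔨, ∀ Y ∈ 𝔨, ⁅X, Y⁆ ∈ subgroupLieAlgebra E H

/-- The subgroup `K` generated by `H` and the connected Lie subgroup `K°` with Lie algebra `𝔨`; the
latter is itself generated by `exp(𝔨)`. -/
def toralSubgroup (H : Subgroup G) (𝔨 : LieSubalgebra ℝ (GroupLieAlgebra 𝓘(ℝ, E) G)) :
    Subgroup G :=
  Subgroup.closure ((H : Set G) ∪ {a | ∃ X ∈ 𝔨, ∃ φ : ℝ → G, IsExpCurve X φ ∧ φ 1 = a})

/-- `P` belongs to `Sym₊(W, Q)^{Ad(L)}`: it is a `Q`-symmetric, positive definite endomorphism of the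
(`Ad(L)`-invariant) subspace `W` that commutes with `Ad(L)`. -/
structure IsInvariantMetric (Q : EuclideanForm (GroupLieAlgebra 𝓘(ℝ, E) G)) (L : Subgroup G)
    (W : Submodule ℝ (GroupLieAlgebra 𝓘(ℝ, E) G)) (P : Module.End ℝ W) : Prop where
  symm : ∀ X Y : W, Q.form (P X) Y = Q.form X (P Y)
  pos : ∀ X : W, X ≠ 0 → 0 < Q.form (P X) X
  ad_comm : ∀ a ∈ L, ∀ X Y : W, (Y : GroupLieAlgebra 𝓘(ℝ, E) G) = Ad E a X →
    (P Y : GroupLieAlgebra 𝓘(ℝ, E) G) = Ad E a (P X)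

/-- The tangent space `𝔪 = 𝔥^⊥` of `M = G/H` at the origin. -/
abbrev totalSpace (Q : EuclideanForm (GroupLieAlgebra 𝓘(ℝ, E) G)) (H : Subgroup G) :
    Submodule ℝ (GroupLieAlgebra 𝓘(ℝ, E) G) :=
  HomogeneousMetric.compl Q (subgroupLieAlgebra E H)

/-- The fibre part `𝔱 = 𝔨 ∩ 𝔥^⊥` of `𝔪`. -/
abbrev fibrePart (Q : EuclideanForm (GroupLieAlgebra 𝓘(ℝ, E) G)) (H : Subgroup G)
    (𝔨 : LieSubalgebra ℝ (GroupLieAlgebra 𝓘(ℝ, E) G)) :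
    Submodule ℝ (GroupLieAlgebra 𝓘(ℝ, E) G) :=
  𝔨.toSubmodule ⊓ totalSpace Q H

/-- The base part `𝔫 = 𝔨^⊥` of `𝔪`, the tangent space of `N = G/K` at the origin. -/
abbrev basePart (Q : EuclideanForm (GroupLieAlgebra 𝓘(ℝ, E) G))
    (𝔨 : LieSubalgebra ℝ (GroupLieAlgebra 𝓘(ℝ, E) G)) :
    Submodule ℝ (GroupLieAlgebra 𝓘(ℝ, E) G) :=
  HomogeneousMetric.compl Q 𝔨

/-- `P` is a `𝔨`-submersion metric: a `G`-invariant metric on `G/H` which preserves the decomposition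
`𝔪 = 𝔱 + 𝔫` and whose restriction to `𝔫` is `Ad(K)`-invariant. -/
structure IsSubmersionMetric (Q : EuclideanForm (GroupLieAlgebra 𝓘(ℝ, E) G)) (H : Subgroup G)
    (𝔨 : LieSubalgebra ℝ (GroupLieAlgebra 𝓘(ℝ, E) G))
    (P : Module.End ℝ (totalSpace Q H)) : Prop where
  metric : IsInvariantMetric Q H (totalSpace Q H) P
  fibre_mem : ∀ X : totalSpace Q H, (X : GroupLieAlgebra 𝓘(ℝ, E) G) ∈ fibrePart Q H 𝔨 →
    (P X : GroupLieAlgebra 𝓘(ℝ, E) G) ∈ fibrePart Q H 𝔨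
  base_mem : ∀ X : totalSpace Q H, (X : GroupLieAlgebra 𝓘(ℝ, E) G) ∈ basePart Q 𝔨 →
    (P X : GroupLieAlgebra 𝓘(ℝ, E) G) ∈ basePart Q 𝔨
  base_metric : IsInvariantMetric Q (toralSubgroup H 𝔨) (basePart Q 𝔨)
    (Q.restrictEnd (totalSpace Q H) (basePart Q 𝔨) P)

/-- Convergence `P n → P'` of endomorphisms of a finite-dimensional space, i.e. in the usual topology
of the finite-dimensional space of endomorphisms; it amounts to convergence at every vector. -/
def EndTendsto {W : Submodule ℝ (GroupLieAlgebra 𝓘(ℝ, E) G)} (P : ℕ → Module.End ℝ W)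
    (P' : Module.End ℝ W) : Prop :=
  ∀ X : W, Tendsto (fun n => P n X) atTop (𝓝 (P' X))

end LieGroup

end

/-! The map `G/H → G/K` is locally a Riemannian submersion whose fibres are flat and totally
geodesic, so O'Neill's formula reduces to an exact identity: `scal_M(P) = scal_N(P_𝔫) - 1/4 ∑ |[e_i,
e_j]_𝔱|²`, where `e` is a `P_𝔫`-orthonormal basis of `𝔫` and the norm is that of `P_𝔱`
(`scal_eq_scal_base_sub_sum`). The correction is linear in `P_𝔱` and is contracted twice with
`P_𝔫⁻¹` (`sum_form_lie_sq_eq`). Since `P_𝔫` has a positive definite limit, its inverse converges,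
and `P_𝔱 → 0` makes the correction vanish. The remaining term converges because `scal_N` is
continuous at an invertible limit (`tendsto_scal`).

The identity is proved algebraically. In a `P`-orthonormal basis `scal` is an isotropy term plus a
quadratic expression in the structure constants (`scal_eq_sum`); traces of `ad` drop out because
`ad` is `Q`-skew. In a basis adapted to `𝔱 ⊕ 𝔫`, torality gives `[𝔨, 𝔱] = 0`, skewness gives `[𝔨, 𝔫]
⊆ 𝔫`, and `Ad(K)`-invariance makes `ad(𝔱)` skew for `P_𝔫`. Almost all blocks then vanish or cancel.

The hypotheses concern `Ad`, whereas this algebra needs `ad`. The bridge is `d/dt Ad(exp tX) Y = [X,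
Y]` at `t = 0`, obtained from the second derivative of the multiplication in the chart at the
identity. -/

noncomputable section

/-! ### Orthogonal projections, dual bases and traces -/

namespace EuclideanForm

variable {V : Type*} [AddCommGroup V] [Module ℝ V] (Q : EuclideanForm V)

variable {Q} in
theorem mem_perp {W : Submodule ℝ V} {x : V} : x ∈ Q.perp W ↔ ∀ y ∈ W, Q.form x y = 0 := by
  rw [LinearMap.BilinForm.mem_orthogonal_iff]
  exact forall₂_congr fun y _ => by rw [Q.symm]

@[simp]
theorem restrict_form_apply (W : Submodule ℝ V) (x y : W) :
    (Q.restrict W).form x y = Q.form x y := rfl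

/-- The Euclidean inner product `Q(P ·, ·)` given by a symmetric positive definite endomorphism. -/
def ofEnd (P : Module.End ℝ V) (hs : ∀ x y, Q.form (P x) y = Q.form x (P y))
    (hp : ∀ x, x ≠ 0 → 0 < Q.form (P x) x) : EuclideanForm V where
  form := Q.form.compLeft P
  symm x y := by simp [hs x y, Q.symm x]
  pos x hx := by simpa using hp x hx

variable [FiniteDimensional ℝ V]

theorem exists_orthonormal_basis : ∃ b : Module.Basis (Fin (Module.finrank ℝ V)) ℝ V,
    ∀ i j, Q.form (b i) (b j) = if i = j then 1 else 0 := by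
  obtain ⟨v, hv⟩ := LinearMap.BilinForm.exists_orthogonal_basis (B := Q.form) ⟨Q.symm⟩
  have hpos : ∀ i, 0 < Q.form (v i) (v i) := fun i => Q.pos _ (v.ne_zero i)
  have hu : ∀ i, IsUnit ((Real.sqrt (Q.form (v i) (v i)))⁻¹) := fun i =>
    (inv_pos.2 (Real.sqrt_pos.2 (hpos i))).ne'.isUnit
  refine ⟨v.isUnitSMul hu, fun i j => ?_⟩
  simp only [Module.Basis.isUnitSMul_apply, map_smul, LinearMap.smul_apply, smul_eq_mul]
  split_ifs with h
  · subst h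
    have := Real.mul_self_sqrt (hpos i).le
    have h0 := (Real.sqrt_pos.2 (hpos i)).ne'
    field_simp
    nlinarith
  · have : Q.form (v i) (v j) = 0 := hv h
    simp [this]

theorem coe_proj_of_mem {W : Submodule ℝ V} {x : V} (hx : x ∈ W) : (Q.proj W x : V) = x := by
  rw [proj, Submodule.projectionOnto_apply_of_mem_left _ hx]

@[simp]
theorem proj_coe (W : Submodule ℝ V) (x : W) : Q.proj W x = x :=
  Subtype.ext (Q.coe_proj_of_mem x.2)

theorem sub_proj_mem (W : Submodule ℝ V) (x : V) : x - Q.proj W x ∈ Q.perp W := by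
  have h : Q.proj W (x - Q.proj W x) = 0 := by rw [map_sub, proj_coe, sub_self]
  rwa [proj, Submodule.projectionOnto_apply_eq_zero_iff] at h

theorem form_proj_left (W : Submodule ℝ V) (x : V) {y : V} (hy : y ∈ W) :
    Q.form (Q.proj W x) y = Q.form x y := by
  have := mem_perp.1 (Q.sub_proj_mem W x) y hy
  simp only [map_sub, LinearMap.sub_apply] at this
  linarith

theorem proj_eq_zero {W : Submodule ℝ V} {x : V} (hx : x ∈ Q.perp W) : Q.proj W x = 0 := by
  rw [proj, Submodule.projectionOnto_apply_eq_zero_iff]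
  exact hx

end EuclideanForm

/-- The coordinates in a basis `b` are the pairings with a family `θ` dual to `b`. -/
theorem Module.Basis.repr_eq_of_dual {V ι : Type*} [AddCommGroup V] [Module ℝ V] [Fintype ι]
    [DecidableEq ι] (B : LinearMap.BilinForm ℝ V) (b : Module.Basis ι ℝ V) (θ : ι → V)
    (h : ∀ i j, B (b i) (θ j) = if i = j then 1 else 0) (x : V) (i : ι) :
    b.repr x i = B x (θ i) := by
  have := congrArg (fun y => B y (θ i)) (b.sum_repr x)
  rw [← this]
  simp [-Module.Basis.sum_repr, h]

/-- Mostly used with `θ = P b` for a `Q(P ·, ·)`-orthonormal basis `b`: coordinates and traces for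
the metric `P` are then read off with `Q` alone. -/
theorem Module.Basis.sum_dual {V ι : Type*} [AddCommGroup V] [Module ℝ V] [Fintype ι]
    [DecidableEq ι] (B : LinearMap.BilinForm ℝ V) (b : Module.Basis ι ℝ V) (θ : ι → V)
    (h : ∀ i j, B (b i) (θ j) = if i = j then 1 else 0) (x : V) :
    ∑ i, B x (θ i) • b i = x := by
  conv_rhs => rw [← b.sum_repr x]
  simp [b.repr_eq_of_dual B θ h]

theorem Module.Basis.trace_eq_of_dual {V ι : Type*} [AddCommGroup V] [Module ℝ V] [Fintype ι]
    [DecidableEq ι] (B : LinearMap.BilinForm ℝ V) (b : Module.Basis ι ℝ V) (θ : ι → V)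
    (h : ∀ i j, B (b i) (θ j) = if i = j then 1 else 0) (T : Module.End ℝ V) :
    LinearMap.trace ℝ V T = ∑ i, B (T (b i)) (θ i) := by
  rw [LinearMap.trace_eq_matrix_trace ℝ b, Matrix.trace]
  simp [LinearMap.toMatrix_apply, b.repr_eq_of_dual B θ h]

theorem isUnit_of_form_pos {V : Type*} [AddCommGroup V] [Module ℝ V] [FiniteDimensional ℝ V]
    (B : LinearMap.BilinForm ℝ V) (P : Module.End ℝ V) (hp : ∀ x, x ≠ 0 → 0 < B (P x) x) :
    IsUnit P := by
  rw [LinearMap.isUnit_iff_ker_eq_bot, LinearMap.ker_eq_bot']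
  intro x hx
  by_contra hne
  have := hp x hne
  simp [hx] at this

theorem IsUnit.apply_inverse {V : Type*} [AddCommGroup V] [Module ℝ V] {P : Module.End ℝ V}
    (hP : IsUnit P) (x : V) : P (Ring.inverse P x) = x :=
  congrArg (fun T : Module.End ℝ V => T x) (Ring.mul_inverse_cancel P hP)

theorem IsUnit.inverse_apply {V : Type*} [AddCommGroup V] [Module ℝ V] {P : Module.End ℝ V}
    (hP : IsUnit P) (x : V) : Ring.inverse P (P x) = x :=
  congrArg (fun T : Module.End ℝ V => T x) (Ring.inverse_mul_cancel P hP)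

/-! ### The scalar curvature in an orthonormal basis -/

theorem sum_rotate {ι : Type*} [Fintype ι] (f : ι → ι → ι → ℝ) :
    ∑ i, ∑ j, ∑ k, f j k i = ∑ i, ∑ j, ∑ k, f i j k := by
  rw [Finset.sum_comm]
  exact Finset.sum_congr rfl fun j _ => Finset.sum_comm

/-- The contraction of structure constants that computes the scalar curvature. -/
theorem sum_connection_coefficients {ι : Type*} [Fintype ι] (c Γ : ι → ι → ι → ℝ)
    (hc : ∀ i j k, c i j k = -c j i k) (htr : ∀ k, ∑ i, c k i i = 0)
    (hΓ : ∀ i j k, Γ i j k = -(1 / 2) * (c i j k + c k i j + c k j i)) :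
    ∑ i, ∑ j, ∑ k, (-(Γ j i k * Γ i k j) + Γ i i k * Γ j k j - c i j k * Γ k i j) =
      ∑ i, ∑ j, ∑ k, (-(1 / 4) * c i j k ^ 2 - 1 / 2 * c i j k * c i k j) := by
  -- As `c i i k = 0`, `Γ i i k` is just `-c k i i`, whose sum over `i` is the trace in `htr`; the
  -- middle term therefore drops out.
  have hself : ∀ i j, c i i j = 0 := fun i j => by linarith [hc i i j]
  have h0 : ∑ i, ∑ j, ∑ k, Γ i i k * Γ j k j = 0 := by
    have : ∀ i j k, Γ i i k * Γ j k j = -(c k i i * Γ j k j) := fun i j k => by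
      rw [hΓ i i k, hself]; ring
    simp only [this, Finset.sum_neg_distrib, neg_eq_zero]
    rw [Finset.sum_comm]
    refine Finset.sum_eq_zero fun j _ => ?_
    rw [Finset.sum_comm]
    refine Finset.sum_eq_zero fun k _ => ?_
    rw [← Finset.sum_mul, htr, zero_mul]
  -- The two summands agree up to differences between an expression and its cyclic shifts in `(i, j,
  -- k)`, which cancel after summation.
  have key : ∀ i j k, -(Γ j i k * Γ i k j) - c i j k * Γ k i j =
      (-(1 / 4) * c i j k ^ 2 - 1 / 2 * c i j k * c i k j)
      + ((1 / 4 * c j k i ^ 2 - 1 / 4 * c i j k ^ 2) + (1 / 4 * c k i j ^ 2 - 1 / 4 * c i j k ^ 2)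
      + (1 / 2 * (c i j k * c j k i) - 1 / 2 * (c j k i * c k i j))) := fun i j k => by
    rw [hΓ j i k, hΓ i k j, hΓ k i j, hc j i k, hc k j i, hc i k j]; ring
  have e1 := sum_rotate fun i j k => 1 / 4 * c i j k ^ 2
  have e2 := sum_rotate fun i j k => 1 / 4 * c j k i ^ 2
  have e3 := sum_rotate fun i j k => 1 / 2 * (c i j k * c j k i)
  have hsplit : ∀ i j k, -(Γ j i k * Γ i k j) + Γ i i k * Γ j k j - c i j k * Γ k i j =
      (-(Γ j i k * Γ i k j) - c i j k * Γ k i j) + Γ i i k * Γ j k j := fun i j k => by ring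
  simp only [hsplit, Finset.sum_add_distrib] at h0 ⊢
  rw [h0]
  simp only [key, Finset.sum_add_distrib, Finset.sum_sub_distrib] at e1 e2 e3 ⊢
  linarith

namespace HomogeneousMetric

variable {𝔤 : Type*} [LieRing 𝔤] [LieAlgebra ℝ 𝔤] [FiniteDimensional ℝ 𝔤]
  (Q : EuclideanForm 𝔤) (𝔥 : LieSubalgebra ℝ 𝔤)

theorem form_bracketM (X Y Z : compl Q 𝔥) :
    Q.form (bracketM Q 𝔥 X Y) Z = Q.form ⁅(X : 𝔤), (Y : 𝔤)⁆ Z :=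
  Q.form_proj_left _ _ Z.2

theorem form_adBracketH (X Y Z W : compl Q 𝔥) :
    Q.form (adBracketH Q 𝔥 X Y Z) W =
      Q.form ⁅(Q.proj 𝔥.toSubmodule ⁅(X : 𝔤), (Y : 𝔤)⁆ : 𝔤), (Z : 𝔤)⁆ W :=
  Q.form_proj_left _ _ W.2

variable {Q 𝔥} {P : Module.End ℝ (compl Q 𝔥)} {ι : Type*} [Fintype ι] [DecidableEq ι]

/-- Unimodularity: the sum is the trace of `Y ↦ [X, Y]_𝔪`, which may be computed in a
`Q`-orthonormal basis instead, where skewness makes every diagonal entry zero. -/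
theorem sum_form_lie_eq_zero (hQ : ∀ X Y Z : 𝔤, Q.form ⁅X, Y⁆ Z = -Q.form Y ⁅X, Z⁆)
    (b : Module.Basis ι ℝ (compl Q 𝔥)) (θ : ι → compl Q 𝔥)
    (hb : ∀ i j, Q.form (b i) (θ j) = if i = j then 1 else 0) (X : compl Q 𝔥) :
    ∑ i, Q.form ⁅(X : 𝔤), (b i : 𝔤)⁆ (θ i) = 0 := by
  have h1 := b.trace_eq_of_dual (Q.restrict _).form θ hb (bracketM Q 𝔥 X)
  obtain ⟨f, hf⟩ := (Q.restrict (compl Q 𝔥)).exists_orthonormal_basis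
  have h2 := f.trace_eq_of_dual (Q.restrict _).form f hf (bracketM Q 𝔥 X)
  simp only [EuclideanForm.restrict_form_apply, form_bracketM] at h1 h2
  rw [← h1, h2]
  refine Finset.sum_eq_zero fun i _ => ?_
  have := hQ X (f i) (f i)
  rw [Q.symm (f i)] at this
  linarith

/-- The scalar curvature in terms of a `Q(P ·, ·)`-orthonormal basis. -/
theorem scal_eq_sum (hQ : ∀ X Y Z : 𝔤, Q.form ⁅X, Y⁆ Z = -Q.form Y ⁅X, Z⁆) (hP : IsUnit P)
    (hs : ∀ X Y : compl Q 𝔥, Q.form (P X) Y = Q.form X (P Y))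
    (b : Module.Basis ι ℝ (compl Q 𝔥))
    (hb : ∀ i j, Q.form (b i) (P (b j)) = if i = j then 1 else 0) :
    scal Q 𝔥 P = ∑ i, ∑ j,
      (Q.form ⁅(Q.proj 𝔥.toSubmodule ⁅(b i : 𝔤), (b j : 𝔤)⁆ : 𝔤), (b i : 𝔤)⁆ (P (b j)) +
        ∑ k, (-(1 / 4) * Q.form ⁅(b i : 𝔤), (b j : 𝔤)⁆ (P (b k)) ^ 2
          - 1 / 2 * Q.form ⁅(b i : 𝔤), (b j : 𝔤)⁆ (P (b k))
            * Q.form ⁅(b i : 𝔤), (b k : 𝔤)⁆ (P (b j)))) := by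
  set Γ : ι → ι → ι → ℝ := fun i j k => Q.form (S Q 𝔥 P (b i) (b j)) (P (b k)) with hΓ
  set c : ι → ι → ι → ℝ := fun i j k => Q.form ⁅(b i : 𝔤), (b j : 𝔤)⁆ (P (b k)) with hc
  have htr := b.trace_eq_of_dual (Q.restrict _).form (fun i => P (b i)) hb
  have hexp := b.sum_dual (Q.restrict _).form (fun i => P (b i)) hb
  simp only [EuclideanForm.restrict_form_apply] at htr hexp
  have hS : ∀ i j k l, Q.form (S Q 𝔥 P (b i) (S Q 𝔥 P (b j) (b k))) (P (b l)) =
      ∑ m, Γ j k m * Γ i m l := fun i j k l => by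
    conv_lhs => rw [← hexp (S Q 𝔥 P (b j) (b k))]
    simp [map_sum, hΓ]
  have hB : ∀ i j k l, Q.form (S Q 𝔥 P (bracketM Q 𝔥 (b i) (b j)) (b k)) (P (b l)) =
      ∑ m, c i j m * Γ m k l := fun i j k l => by
    conv_lhs => rw [← hexp (bracketM Q 𝔥 (b i) (b j))]
    simp [map_sum, hΓ, hc, form_bracketM]
  -- Testing `S` against `P (b k)` cancels the `P⁻¹` in its definition, which leaves a Koszul
  -- formula in the structure constants.
  have hΓc : ∀ i j k, Γ i j k = -(1 / 2) * (c i j k + c k i j + c k j i) := fun i j k => by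
    have := form_S Q 𝔥 P (b i) (b j) (P (b k))
    simp only [form_bracketM, hP.inverse_apply] at this
    simp only [hΓ, hc]
    linarith
  have hskew : ∀ i j k, c i j k = -c j i k := fun i j k => by
    simp only [hc]
    rw [← lie_skew, map_neg, LinearMap.neg_apply]
  rw [scal, htr]
  have h1 : ∀ i, Q.form (((Ring.inverse P * Ric Q 𝔥 P) (b i) : compl Q 𝔥) : 𝔤) (P (b i)) =
      ∑ j, (Q.form ⁅(Q.proj 𝔥.toSubmodule ⁅(b i : 𝔤), (b j : 𝔤)⁆ : 𝔤), (b i : 𝔤)⁆ (P (b j)) +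
        ∑ k, (-(Γ j i k * Γ i k j) + Γ i i k * Γ j k j - c i j k * Γ k i j)) := fun i => by
    rw [Module.End.mul_apply, ← hs, hP.apply_inverse, form_Ric, htr]
    refine Finset.sum_congr rfl fun j _ => ?_
    rw [← form_adBracketH]
    simp only [Rm, LinearMap.flip_apply, LinearMap.mk₂_apply, LinearMap.sub_apply,
      Module.End.mul_apply, Submodule.coe_sub, map_sub, hS, hB, Finset.sum_add_distrib,
      Finset.sum_sub_distrib, Finset.sum_neg_distrib]
    ring
  rw [Finset.sum_congr rfl fun i _ => h1 i]
  have := sum_connection_coefficients c Γ hskew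
    (fun k => sum_form_lie_eq_zero hQ b (fun i => P (b i)) hb (b k)) hΓc
  simp only [Finset.sum_add_distrib, hc] at this ⊢
  rw [this]

end HomogeneousMetric

/-- On an invariant subspace the projections built into `restrictEnd` act trivially, so it is the
genuine block of `P`. -/
theorem EuclideanForm.coe_restrictEnd {V : Type*} [AddCommGroup V] [Module ℝ V]
    [FiniteDimensional ℝ V] (Q : EuclideanForm V) {W U : Submodule ℝ V} (hUW : U ≤ W)
    {P : Module.End ℝ W} (hP : ∀ x : W, (x : V) ∈ U → (P x : V) ∈ U) (x : U) :
    P (Submodule.inclusion hUW x) = Submodule.inclusion hUW (Q.restrictEnd W U P x) := by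
  have h : Q.proj W (x : V) = Submodule.inclusion hUW x :=
    Subtype.ext (Q.coe_proj_of_mem (hUW x.2))
  refine Subtype.ext ?_
  simp only [restrictEnd, LinearMap.comp_apply, Submodule.subtype_apply, h,
    Submodule.coe_inclusion]
  rw [Q.coe_proj_of_mem (hP _ x.2)]

namespace HomogeneousMetric

/-! ### Toral subalgebras -/

variable {𝔤 : Type*} [LieRing 𝔤] [LieAlgebra ℝ 𝔤]
  {Q : EuclideanForm 𝔤} {𝔥 𝔨 : LieSubalgebra ℝ 𝔤}

theorem lie_mem_compl (hQ : ∀ X Y Z : 𝔤, Q.form ⁅X, Y⁆ Z = -Q.form Y ⁅X, Z⁆) {X Y : 𝔤}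
    (hX : X ∈ 𝔨) (hY : Y ∈ compl Q 𝔨) : ⁅X, Y⁆ ∈ compl Q 𝔨 := by
  rw [EuclideanForm.mem_perp] at hY ⊢
  intro Z hZ
  rw [hQ, hY _ (𝔨.lie_mem hX hZ), neg_zero]

variable (Q 𝔥 𝔨) in
/-- The vertical space `𝔱 = 𝔨 ∩ 𝔥^⊥`. -/
abbrev vertical : Submodule ℝ 𝔤 := 𝔨.toSubmodule ⊓ compl Q 𝔥

theorem vertical_le : vertical Q 𝔥 𝔨 ≤ compl Q 𝔥 := inf_le_right

theorem compl_le (h𝔨 : 𝔥 ≤ 𝔨) : compl Q 𝔨 ≤ compl Q 𝔥 := fun X hX => by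
  rw [EuclideanForm.mem_perp] at hX ⊢
  exact fun Y hY => hX Y (h𝔨 hY)

/-- With `Z = [X, Y] ∈ 𝔥`, skewness gives `Q(Z, Z) = -Q(Y, [X, Z])`; torality puts `[X, Z]` in `𝔥`,
to which `Y` is orthogonal. This is the only use of torality beyond `𝔥 ≤ 𝔨`. -/
theorem lie_vertical_eq_zero (hQ : ∀ X Y Z : 𝔤, Q.form ⁅X, Y⁆ Z = -Q.form Y ⁅X, Z⁆)
    (h𝔨 : 𝔥 ≤ 𝔨) (hlie : ∀ X ∈ 𝔨, ∀ Y ∈ 𝔨, ⁅X, Y⁆ ∈ 𝔥) {X Y : 𝔤} (hX : X ∈ 𝔨)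
    (hY : Y ∈ vertical Q 𝔥 𝔨) : ⁅X, Y⁆ = 0 := by
  by_contra hne
  have hZ := hlie X hX Y hY.1
  have h1 := Q.pos _ hne
  rw [hQ, EuclideanForm.mem_perp.1 hY.2 _ (hlie X hX _ (h𝔨 hZ))] at h1
  simp at h1

variable [FiniteDimensional ℝ 𝔤]

/-- The decomposition `𝔪 = 𝔱 ⊕ 𝔫`. -/
def verticalProdEquiv (h𝔨 : 𝔥 ≤ 𝔨) : (vertical Q 𝔥 𝔨 × compl Q 𝔨) ≃ₗ[ℝ] compl Q 𝔥 :=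
  LinearEquiv.ofBijective
    ((Submodule.inclusion vertical_le).coprod (Submodule.inclusion (compl_le h𝔨))) <| by
    constructor
    · rw [← LinearMap.ker_eq_bot, LinearMap.ker_eq_bot']
      rintro ⟨x, y⟩ hxy
      have h := congrArg Subtype.val hxy
      simp only [LinearMap.coprod_apply, Submodule.coe_add, Submodule.coe_inclusion,
        ZeroMemClass.coe_zero] at h
      have hx : (x : 𝔤) = 0 := by
        by_contra hne
        have h1 := Q.pos _ hne
        rw [eq_neg_of_add_eq_zero_left h] at h1
        have h2 := EuclideanForm.mem_perp.1 y.2 x x.2.1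
        rw [eq_neg_of_add_eq_zero_left h] at h2
        simp only [map_neg, LinearMap.neg_apply] at h1 h2
        linarith
      rw [hx, zero_add] at h
      exact Prod.ext (Subtype.ext hx) (Subtype.ext h)
    · intro x
      have h1 := Q.sub_proj_mem 𝔨.toSubmodule x
      have h2 : (Q.proj 𝔨.toSubmodule x : 𝔤) ∈ compl Q 𝔥 := by
        have := (compl Q 𝔥).sub_mem x.2 (compl_le h𝔨 h1)
        simpa using this
      refine ⟨(⟨Q.proj 𝔨.toSubmodule x, (Q.proj 𝔨.toSubmodule x).2, h2⟩, ⟨_, h1⟩), ?_⟩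
      ext
      simp

theorem verticalProdEquiv_apply (h𝔨 : 𝔥 ≤ 𝔨) (x : vertical Q 𝔥 𝔨 × compl Q 𝔨) :
    verticalProdEquiv h𝔨 x =
      Submodule.inclusion vertical_le x.1 + Submodule.inclusion (compl_le h𝔨) x.2 := rfl

variable {ι κ : Type*} [Fintype ι] [DecidableEq ι] [Fintype κ] [DecidableEq κ]

/-- Orthogonally `𝔨 = 𝔥 ⊕ 𝔱`, so the two projections differ by the `𝔱`-component. This compares the
isotropy terms of `G/K` and `G/H`. -/
theorem proj_eq_proj_add_sum (h𝔨 : 𝔥 ≤ 𝔨) (b : Module.Basis ι ℝ (vertical Q 𝔥 𝔨))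
    (θ : ι → vertical Q 𝔥 𝔨) (hb : ∀ i j, Q.form (b i) (θ j) = if i = j then 1 else 0) (w : 𝔤) :
    (Q.proj 𝔨.toSubmodule w : 𝔤) = Q.proj 𝔥.toSubmodule w + ∑ i, Q.form w (θ i) • (b i : 𝔤) := by
  have hmem : (Q.proj 𝔨.toSubmodule w - Q.proj 𝔥.toSubmodule w : 𝔤) ∈ vertical Q 𝔥 𝔨 := by
    refine ⟨Submodule.sub_mem _ (Q.proj 𝔨.toSubmodule w).2 (h𝔨 (Q.proj 𝔥.toSubmodule w).2),
      EuclideanForm.mem_perp.2 fun y hy => ?_⟩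
    rw [map_sub, LinearMap.sub_apply, Q.form_proj_left _ _ (h𝔨 hy), Q.form_proj_left _ _ hy,
      sub_self]
  have h1 := b.sum_dual (Q.restrict _).form θ hb ⟨_, hmem⟩
  have h2 := congrArg Subtype.val h1
  simp only [EuclideanForm.restrict_form_apply, map_sub, LinearMap.sub_apply,
    AddSubmonoidClass.coe_finsetSum, Submodule.coe_smul] at h2
  rw [← sub_eq_iff_eq_add', ← h2]
  refine Finset.sum_congr rfl fun i _ => ?_
  rw [Q.form_proj_left _ _ (θ i).2.1, Q.symm (Q.proj 𝔥.toSubmodule w),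
    EuclideanForm.mem_perp.1 (θ i).2.2 _ (Q.proj 𝔥.toSubmodule w).2, sub_zero]

-- Here `A` stands for the `𝔫`-components of `[𝔱, 𝔫]`, `B` for the `𝔱`-components of `[𝔫, 𝔫]`, `D`
-- for the `𝔥`-isotropy terms and `F` for the base sums. By skewness of `A` the block starting in
-- `𝔱` gives `+A²/4`, which cancels the `-A²/4` of the block starting in `𝔫`. Two cross terms `AB/2`
-- add up to the excess of the `𝔨`-isotropy term over the `𝔥`-isotropy term. Only `-B²/4` is left.
omit [DecidableEq ι] [DecidableEq κ] in
theorem sum_submersion_coefficients (A : ι → κ → κ → ℝ) (B : κ → κ → ι → ℝ) (D F : κ → κ → ℝ)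
    (hA : ∀ i j k, A i k j = -A i j k) :
    ∑ i, ∑ j, ∑ k, (-(1 / 4) * A i j k ^ 2 - 1 / 2 * A i j k * A i k j) +
      ∑ j, (∑ i, ∑ k, (-(1 / 4) * (-A i j k) ^ 2 - 1 / 2 * -A i j k * B j k i) +
        ∑ i, (D j i + (∑ k, (-(1 / 4) * B j i k ^ 2 - 1 / 2 * B j i k * -A k j i) + F j i))) =
    ∑ i, ∑ j, (D i j + ∑ k, B i j k * A k i j + F i j) - 1 / 4 * ∑ i, ∑ j, ∑ k, B i j k ^ 2 := by
  have hrot : ∑ i, ∑ j, ∑ k, B i j k * A k i j = ∑ i, ∑ j, ∑ k, A j i k * B i k j :=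
    Finset.sum_congr rfl fun i _ => by
      rw [Finset.sum_comm]; simp only [mul_comm]
  have hsq : ∑ i, ∑ j, ∑ k, A i j k ^ 2 = ∑ j, ∑ i, ∑ k, A i j k ^ 2 := Finset.sum_comm
  have r1 : ∀ i j k, -(1 / 4) * A i j k ^ 2 - 1 / 2 * A i j k * A i k j = 1 / 4 * A i j k ^ 2 :=
    fun i j k => by rw [hA]; ring
  have r2 : ∀ i j k, -(1 / 4) * (-A i j k) ^ 2 - 1 / 2 * -A i j k * B j k i =
      1 / 2 * (A i j k * B j k i) - 1 / 4 * A i j k ^ 2 := fun i j k => by ring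
  have r3 : ∀ i j k, -(1 / 4) * B j i k ^ 2 - 1 / 2 * B j i k * -A k j i =
      1 / 2 * (B j i k * A k j i) - 1 / 4 * B j i k ^ 2 := fun i j k => by ring
  simp only [r1, r2, r3, Finset.sum_add_distrib, Finset.sum_sub_distrib, ← Finset.mul_sum]
  linarith

/-- The scalar curvature of a submersion metric with flat totally geodesic fibres, in terms of
the scalar curvature of the base. -/
theorem scal_eq_scal_base_sub_sum
    (hQ : ∀ X Y Z : 𝔤, Q.form ⁅X, Y⁆ Z = -Q.form Y ⁅X, Z⁆) (h𝔨 : 𝔥 ≤ 𝔨)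
    (hlie : ∀ X ∈ 𝔨, ∀ Y ∈ 𝔨, ⁅X, Y⁆ ∈ 𝔥)
    {P : Module.End ℝ (compl Q 𝔥)} {Pt : Module.End ℝ (vertical Q 𝔥 𝔨)}
    {Pn : Module.End ℝ (compl Q 𝔨)} (hP : IsUnit P) (hPn : IsUnit Pn)
    (hs : ∀ X Y : compl Q 𝔥, Q.form (P X) Y = Q.form X (P Y))
    (hsn : ∀ X Y : compl Q 𝔨, Q.form (Pn X) Y = Q.form X (Pn Y))
    (hPt' : ∀ X, P (Submodule.inclusion vertical_le X) = Submodule.inclusion vertical_le (Pt X))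
    (hPn' : ∀ X, P (Submodule.inclusion (compl_le h𝔨) X) = Submodule.inclusion (compl_le h𝔨) (Pn X))
    (hinv : ∀ X ∈ 𝔨, ∀ Y Z : compl Q 𝔨, Q.form ⁅X, (Y : 𝔤)⁆ (Pn Z) = -Q.form ⁅X, (Z : 𝔤)⁆ (Pn Y))
    (g : Module.Basis ι ℝ (vertical Q 𝔥 𝔨)) (e : Module.Basis κ ℝ (compl Q 𝔨))
    (hg : ∀ i j, Q.form (g i) (Pt (g j)) = if i = j then 1 else 0)
    (he : ∀ i j, Q.form (e i) (Pn (e j)) = if i = j then 1 else 0) :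
    scal Q 𝔥 P = scal Q 𝔨 Pn
      - 1 / 4 * ∑ i, ∑ j, ∑ k, Q.form ⁅(e i : 𝔤), (e j : 𝔤)⁆ (Pt (g k)) ^ 2 := by
  set b : Module.Basis (ι ⊕ κ) ℝ (compl Q 𝔥) := (g.prod e).map (verticalProdEquiv h𝔨) with hb
  have hbl : ∀ i, b (Sum.inl i) = Submodule.inclusion vertical_le (g i) := fun i => by
    simp [hb, verticalProdEquiv_apply]
  have hbr : ∀ i, b (Sum.inr i) = Submodule.inclusion (compl_le h𝔨) (e i) := fun i => by
    simp [hb, verticalProdEquiv_apply]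
  have hnt : ∀ (x : 𝔤) (y : vertical Q 𝔥 𝔨), x ∈ compl Q 𝔨 → Q.form x y = 0 := fun x y hx =>
    EuclideanForm.mem_perp.1 hx y y.2.1
  have htn : ∀ (x : vertical Q 𝔥 𝔨) (y : 𝔤), y ∈ compl Q 𝔨 → Q.form x y = 0 := fun x y hy => by
    rw [Q.symm, hnt y x hy]
  have hbb : ∀ i j, Q.form (b i) (P (b j)) = if i = j then 1 else 0 := by
    rintro (i | i) (j | j) <;>
      simp [hbl, hbr, hPt', hPn', hg, he, htn _ _ (Pn _).2, hnt _ _ (e _).2]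
  rw [scal_eq_sum hQ hP hs b hbb, scal_eq_sum hQ hPn hsn e he]
  simp only [Fintype.sum_sum_type, hbl, hbr, hPt', hPn', Submodule.coe_inclusion]
  have hgg : ∀ i j, ⁅(g i : 𝔤), (g j : 𝔤)⁆ = 0 := fun i j =>
    lie_vertical_eq_zero hQ h𝔨 hlie (g i).2.1 (g j).2
  have hge : ∀ i j, ⁅(g i : 𝔤), (e j : 𝔤)⁆ ∈ compl Q 𝔨 := fun i j =>
    lie_mem_compl hQ (g i).2.1 (e j).2
  have heg : ∀ i j, ⁅(e i : 𝔤), (g j : 𝔤)⁆ = -⁅(g j : 𝔤), (e i : 𝔤)⁆ := fun i j =>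
    (lie_skew _ _).symm
  have hpge : ∀ i j, Q.proj 𝔥.toSubmodule ⁅(g i : 𝔤), (e j : 𝔤)⁆ = 0 := fun i j =>
    Q.proj_eq_zero (by
      rw [EuclideanForm.mem_perp]
      exact fun Y hY => EuclideanForm.mem_perp.1 (compl_le h𝔨 (hge i j)) Y hY)
  have hA : ∀ i j k, Q.form ⁅(g i : 𝔤), (e k : 𝔤)⁆ (Pn (e j)) =
      -Q.form ⁅(g i : 𝔤), (e j : 𝔤)⁆ (Pn (e k)) := fun i j k => hinv _ (g i).2.1 _ _
  have hAt : ∀ i j k, Q.form ⁅(g i : 𝔤), (e j : 𝔤)⁆ (Pt (g k)) = 0 := fun i j k =>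
    hnt _ _ (hge i j)
  -- The isotropy algebra of the base is `𝔨`, not `𝔥`; the `𝔱`-part of the bracket produces the
  -- extra products `B A`.
  have hpk : ∀ i j, Q.form ⁅(Q.proj 𝔨.toSubmodule ⁅(e i : 𝔤), (e j : 𝔤)⁆ : 𝔤), (e i : 𝔤)⁆ (Pn (e j))
      = Q.form ⁅(Q.proj 𝔥.toSubmodule ⁅(e i : 𝔤), (e j : 𝔤)⁆ : 𝔤), (e i : 𝔤)⁆ (Pn (e j))
        + ∑ k, Q.form ⁅(e i : 𝔤), (e j : 𝔤)⁆ (Pt (g k))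
          * Q.form ⁅(g k : 𝔤), (e i : 𝔤)⁆ (Pn (e j)) := fun i j => by
    rw [proj_eq_proj_add_sum h𝔨 g (fun k => Pt (g k)) hg, add_lie, map_add, LinearMap.add_apply,
      sum_lie]
    simp [map_sum, LinearMap.sum_apply]
  simp only [hgg, heg, hpge, hAt, hpk, map_neg, map_zero, LinearMap.neg_apply,
    LinearMap.zero_apply, ZeroMemClass.coe_zero, zero_lie, neg_zero, mul_zero,
    Finset.sum_const_zero, zero_add, add_zero, ne_eq, OfNat.ofNat_ne_zero,
    not_false_eq_true, zero_pow, sub_self]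
  exact sum_submersion_coefficients (fun i j k => Q.form ⁅(g i : 𝔤), (e j : 𝔤)⁆ (Pn (e k)))
    (fun i j k => Q.form ⁅(e i : 𝔤), (e j : 𝔤)⁆ (Pt (g k))) _ _ hA

end HomogeneousMetric

/-! ### Convergence tested on inner products -/

namespace EuclideanForm

variable {V : Type*} [AddCommGroup V] [Module ℝ V]

theorem bilin_eq_sum (Q : EuclideanForm V) {ν : Type*} [Fintype ν] [DecidableEq ν]
    (f : Module.Basis ν ℝ V) (hf : ∀ i j, Q.form (f i) (f j) = if i = j then 1 else 0)
    (B : LinearMap.BilinForm ℝ V) (u v : V) :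
    B u v = ∑ i, ∑ j, Q.form u (f i) * Q.form v (f j) * B (f i) (f j) := by
  conv_lhs => rw [← f.sum_dual Q.form f hf u, ← f.sum_dual Q.form f hf v]
  simp only [map_sum, LinearMap.sum_apply, map_smul, LinearMap.smul_apply, smul_eq_mul,
    Finset.mul_sum]
  rw [Finset.sum_comm]
  exact Finset.sum_congr rfl fun i _ => Finset.sum_congr rfl fun j _ => by ring

/-- The `Q(P ·, ·)`-trace of a bilinear form, in a `Q`-orthonormal basis. -/
theorem sum_bilin_self_eq (Q : EuclideanForm V) {κ ν : Type*} [Fintype κ] [DecidableEq κ]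
    [Fintype ν] [DecidableEq ν] {P : Module.End ℝ V} (hP : IsUnit P)
    (hs : ∀ x y, Q.form (P x) y = Q.form x (P y)) (e : Module.Basis κ ℝ V)
    (he : ∀ i j, Q.form (e i) (P (e j)) = if i = j then 1 else 0) (f : Module.Basis ν ℝ V)
    (hf : ∀ i j, Q.form (f i) (f j) = if i = j then 1 else 0) (B : LinearMap.BilinForm ℝ V) :
    ∑ i, B (e i) (e i) =
      ∑ a, ∑ c, Q.form (Ring.inverse P (f a)) (f c) * B (f a) (f c) := by
  -- In an orthonormal basis of `Q(P ·, ·)`, `P⁻¹` is `∑ e_i ⊗ e_i`: the coefficient of `P⁻¹ f_a`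
  -- along `e_i` is `Q(f_a, e_i)`.
  have hinv : ∀ a c, Q.form (Ring.inverse P (f a)) (f c) =
      ∑ i, Q.form (e i) (f a) * Q.form (e i) (f c) := fun a c => by
    conv_lhs => rw [← e.sum_dual Q.form (fun i => P (e i)) he (Ring.inverse P (f a))]
    simp only [← hs, hP.apply_inverse, map_sum, LinearMap.sum_apply, map_smul,
      LinearMap.smul_apply, smul_eq_mul, Q.symm (f a)]
  simp only [hinv, Finset.sum_mul]
  rw [Finset.sum_congr rfl fun i _ => Q.bilin_eq_sum f hf B (e i) (e i), Finset.sum_comm]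
  exact Finset.sum_congr rfl fun a _ => Finset.sum_comm

/-- Weak convergence of a sequence of vectors: the convergence of all inner products. -/
def VecTendsto (Q : EuclideanForm V) (x : ℕ → V) (y : V) : Prop :=
  ∀ z, Tendsto (fun n => Q.form (x n) z) atTop (𝓝 (Q.form y z))

variable {Q : EuclideanForm V} [FiniteDimensional ℝ V]

theorem VecTendsto.apply {T : ℕ → Module.End ℝ V} {T' : Module.End ℝ V} {x : ℕ → V} {x' : V}
    (hT : ∀ y, Q.VecTendsto (fun n => T n y) (T' y)) (hx : Q.VecTendsto x x') :
    Q.VecTendsto (fun n => T n (x n)) (T' x') := fun z => by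
  obtain ⟨f, hf⟩ := Q.exists_orthonormal_basis
  have h : ∀ (T : Module.End ℝ V) (y : V),
      Q.form (T y) z = ∑ i, Q.form y (f i) * Q.form (T (f i)) z := fun T y => by
    conv_lhs => rw [← f.sum_dual Q.form f hf y]
    simp [map_sum, LinearMap.sum_apply]
  rw [h T' x']
  exact (tendsto_finsetSum _ fun i _ => (hx _).mul (hT _ _)).congr fun n => (h _ _).symm

theorem VecTendsto.bilin {B : LinearMap.BilinForm ℝ V} {x y : ℕ → V} {x' y' : V}
    (hx : Q.VecTendsto x x') (hy : Q.VecTendsto y y') :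
    Tendsto (fun n => B (x n) (y n)) atTop (𝓝 (B x' y')) := by
  obtain ⟨f, hf⟩ := Q.exists_orthonormal_basis
  have h : ∀ u v, B u v = ∑ i, ∑ j, Q.form u (f i) * Q.form v (f j) * B (f i) (f j) :=
      fun u v => by
    exact Q.bilin_eq_sum f hf B u v
  rw [h x' y']
  exact (tendsto_finsetSum _ fun i _ => tendsto_finsetSum _ fun j _ =>
    ((hx _).mul (hy _)).mul tendsto_const_nhds).congr fun n => (h _ _).symm

/-- Cramer's rule: in a fixed basis the inverse is the adjugate divided by the determinant, and the
limiting determinant is nonzero. -/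
theorem VecTendsto.inverse {P : ℕ → Module.End ℝ V} {P' : Module.End ℝ V}
    (hP : ∀ n, IsUnit (P n)) (hP' : IsUnit P')
    (h : ∀ y, Q.VecTendsto (fun n => P n y) (P' y)) (x : V) :
    Q.VecTendsto (fun n => Ring.inverse (P n) x) (Ring.inverse P' x) := fun y => by
  classical
  obtain ⟨f, hf⟩ := Q.exists_orthonormal_basis
  set M := LinearMap.toMatrixAlgEquiv f with hM
  have hent : ∀ T i j, M T i j = Q.form (T (f j)) (f i) := fun T i j => by
    rw [hM, LinearMap.toMatrixAlgEquiv_apply, f.repr_eq_of_dual Q.form f hf]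
  have hinv : ∀ T, IsUnit T → M (Ring.inverse T) = (M T)⁻¹ := fun T hT => by
    refine (Matrix.inv_eq_left_inv ?_).symm
    rw [hM, ← map_mul, Ring.inverse_mul_cancel T hT, map_one]
  have hlim : Tendsto (fun n => M (P n)) atTop (𝓝 (M P')) := by
    refine tendsto_pi_nhds.2 fun i => tendsto_pi_nhds.2 fun j => ?_
    simp only [hent]
    exact h _ _
  have hdet : (M P').det ≠ 0 := by
    rw [← isUnit_iff_ne_zero, ← Matrix.isUnit_iff_isUnit_det]
    exact hP'.map M
  have hlim' : Tendsto (fun n => M (Ring.inverse (P n))) atTop (𝓝 (M (Ring.inverse P'))) := by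
    rw [hinv _ hP']
    simp only [hinv _ (hP _), Matrix.inv_def, Ring.inverse_eq_inv']
    exact (((continuous_id.matrix_det.tendsto _).comp hlim).inv₀ hdet).smul
      ((continuous_id.matrix_adjugate.tendsto _).comp hlim)
  have hexp : ∀ T : Module.End ℝ V, Q.form (T x) y =
      ∑ i, ∑ j, Q.form x (f i) * Q.form y (f j) * M T j i := fun T => by
    conv_lhs => rw [← f.sum_dual Q.form f hf x, ← f.sum_dual Q.form f hf y]
    simp only [map_sum, LinearMap.sum_apply, map_smul, LinearMap.smul_apply, smul_eq_mul,
      Finset.mul_sum, hent]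
    rw [Finset.sum_comm]
    exact Finset.sum_congr rfl fun i _ => Finset.sum_congr rfl fun j _ => by ring
  simp only [hexp]
  exact tendsto_finsetSum _ fun i _ => tendsto_finsetSum _ fun j _ =>
    tendsto_const_nhds.mul (tendsto_pi_nhds.1 (tendsto_pi_nhds.1 hlim' j) i)

theorem tendsto_trace {T : ℕ → Module.End ℝ V} {T' : Module.End ℝ V}
    (hT : ∀ y, Q.VecTendsto (fun n => T n y) (T' y)) :
    Tendsto (fun n => LinearMap.trace ℝ V (T n)) atTop (𝓝 (LinearMap.trace ℝ V T')) := by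
  obtain ⟨f, hf⟩ := Q.exists_orthonormal_basis
  simp only [f.trace_eq_of_dual Q.form f hf]
  exact tendsto_finsetSum _ fun i _ => hT _ _

end EuclideanForm

/-! ### Continuity of the scalar curvature, and the collapse -/

namespace HomogeneousMetric

variable {𝔤 : Type*} [LieRing 𝔤] [LieAlgebra ℝ 𝔤] [FiniteDimensional ℝ 𝔤]
  {Q : EuclideanForm 𝔤} {𝔥 𝔨 : LieSubalgebra ℝ 𝔤}

theorem tendsto_S {P : ℕ → Module.End ℝ (compl Q 𝔥)} {P' : Module.End ℝ (compl Q 𝔥)}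
    (hP : ∀ n, IsUnit (P n)) (hP' : IsUnit P')
    (h : ∀ X, (Q.restrict (compl Q 𝔥)).VecTendsto (fun n => P n X) (P' X)) (X Y : compl Q 𝔥) :
    (Q.restrict (compl Q 𝔥)).VecTendsto (fun n => S Q 𝔥 (P n) X Y) (S Q 𝔥 P' X Y) := fun Z => by
  have hS : ∀ P, (Q.restrict (compl Q 𝔥)).form (S Q 𝔥 P X Y) Z =
      -(1 / 2) * (Q.form (bracketM Q 𝔥 X Y) Z
        + (Q.restrict (compl Q 𝔥)).form.compLeft ((bracketM Q 𝔥).flip X) (Ring.inverse P Z) (P Y)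
        + (Q.restrict (compl Q 𝔥)).form.compLeft ((bracketM Q 𝔥).flip Y) (Ring.inverse P Z) (P X))
      := fun P => by
    have := form_S Q 𝔥 P X Y Z
    simp only [EuclideanForm.restrict_form_apply, LinearMap.BilinForm.compLeft_apply,
      LinearMap.flip_apply]
    linarith
  have hinv := EuclideanForm.VecTendsto.inverse hP hP' h Z
  simp only [hS]
  exact ((tendsto_const_nhds.add (hinv.bilin (h Y))).add (hinv.bilin (h X))).const_mul _

/-- `S`, `Rm`, `Ric` and `scal` are polynomial in `P` and `P⁻¹`, and inversion is continuous at the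
invertible limit. -/
theorem tendsto_scal {P : ℕ → Module.End ℝ (compl Q 𝔥)} {P' : Module.End ℝ (compl Q 𝔥)}
    (hP : ∀ n, IsUnit (P n)) (hP' : IsUnit P')
    (h : ∀ X, (Q.restrict (compl Q 𝔥)).VecTendsto (fun n => P n X) (P' X)) :
    Tendsto (fun n => scal Q 𝔥 (P n)) atTop (𝓝 (scal Q 𝔥 P')) := by
  have hS := tendsto_S hP hP' h
  refine EuclideanForm.tendsto_trace (Q := Q.restrict (compl Q 𝔥)) fun X => ?_
  simp only [Module.End.mul_apply]
  refine EuclideanForm.VecTendsto.apply (EuclideanForm.VecTendsto.inverse hP hP' h) fun Y => ?_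
  simp only [EuclideanForm.restrict_form_apply, form_Ric]
  refine EuclideanForm.tendsto_trace (Q := Q.restrict (compl Q 𝔥)) fun Z W => ?_
  simp only [LinearMap.flip_apply, Rm, LinearMap.mk₂_apply, LinearMap.sub_apply,
    Module.End.mul_apply, map_sub]
  exact (tendsto_const_nhds.sub
    ((EuclideanForm.VecTendsto.apply (fun _ => hS _ _) (hS _ _) W).sub
      (EuclideanForm.VecTendsto.apply (fun _ => hS _ _) (hS _ _) W))).sub (hS _ _ W)

/-- The contribution of the curvature of the horizontal distribution, in a fixed basis. -/
theorem sum_form_lie_sq_eq {ι κ : Type*} [Fintype ι] [DecidableEq ι] [Fintype κ] [DecidableEq κ]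
    {Pt : Module.End ℝ (vertical Q 𝔥 𝔨)} {Pn : Module.End ℝ (compl Q 𝔨)} (hPn : IsUnit Pn)
    (hst : ∀ X Y : vertical Q 𝔥 𝔨, Q.form (Pt X) Y = Q.form X (Pt Y))
    (hsn : ∀ X Y : compl Q 𝔨, Q.form (Pn X) Y = Q.form X (Pn Y))
    (g : Module.Basis ι ℝ (vertical Q 𝔥 𝔨)) (e : Module.Basis κ ℝ (compl Q 𝔨))
    (hg : ∀ i j, Q.form (g i) (Pt (g j)) = if i = j then 1 else 0)
    (he : ∀ i j, Q.form (e i) (Pn (e j)) = if i = j then 1 else 0)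
    {ν : Type*} [Fintype ν] [DecidableEq ν] (f : Module.Basis ν ℝ (compl Q 𝔨))
    (hf : ∀ i j, Q.form (f i) (f j) = if i = j then 1 else 0) :
    ∑ i, ∑ j, ∑ k, Q.form ⁅(e i : 𝔤), (e j : 𝔤)⁆ (Pt (g k)) ^ 2 =
      ∑ a, ∑ b, ∑ c, ∑ d, Q.form (Ring.inverse Pn (f a)) (f c) * Q.form (Ring.inverse Pn (f b)) (f d)
        * Q.form (Pt (Q.proj _ ⁅(f a : 𝔤), (f b : 𝔤)⁆)) (Q.proj (vertical Q 𝔥 𝔨) ⁅(f c : 𝔤), (f d : 𝔤)⁆) := by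
  set Φ : compl Q 𝔨 →ₗ[ℝ] compl Q 𝔨 →ₗ[ℝ] vertical Q 𝔥 𝔨 :=
    LinearMap.mk₂ ℝ (fun X Y => Q.proj (vertical Q 𝔥 𝔨) ⁅(X : 𝔤), (Y : 𝔤)⁆)
      (by simp) (by simp) (by simp) (by simp) with hΦ
  set B := (Q.restrict (vertical Q 𝔥 𝔨)).form.compLeft Pt with hB
  -- Parseval for the inner product `Q(Pt ·, ·)`, in which `g` is orthonormal.
  have h1 : ∀ w : 𝔤, ∑ k, Q.form w (Pt (g k)) ^ 2 =
      B (Q.proj (vertical Q 𝔥 𝔨) w) (Q.proj (vertical Q 𝔥 𝔨) w) := fun w => by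
    have hw : ∀ k, Q.form w (Pt (g k)) = Q.form (Q.proj (vertical Q 𝔥 𝔨) w) (Pt (g k)) :=
      fun k => (Q.form_proj_left _ _ (Pt (g k)).2).symm
    have hu := congrArg (B (Q.proj (vertical Q 𝔥 𝔨) w)) (g.sum_dual (Q.restrict _).form
      (fun k => Pt (g k)) hg (Q.proj (vertical Q 𝔥 𝔨) w))
    rw [← hu, map_sum]
    refine Finset.sum_congr rfl fun k _ => ?_
    rw [hw, map_smul, smul_eq_mul, sq]
    exact congrArg (_ * ·) (hst _ (g k)).symm
  -- The indices `i` and `j` are contracted one at a time; each contraction trades `∑ e_i ⊗ e_i` for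
  -- `Pn⁻¹` in the basis `f`.
  have h2 : ∀ Y, ∑ i, B (Φ (e i) Y) (Φ (e i) Y) =
      ∑ a, ∑ c, Q.form (Ring.inverse Pn (f a)) (f c) * B (Φ (f a) Y) (Φ (f c) Y) := fun Y =>
    (Q.restrict (compl Q 𝔨)).sum_bilin_self_eq hPn hsn e he f hf
      (B.compl₁₂ (Φ.flip Y) (Φ.flip Y))
  have h3 : ∀ a c, ∑ j, B (Φ (f a) (e j)) (Φ (f c) (e j)) =
      ∑ b, ∑ d, Q.form (Ring.inverse Pn (f b)) (f d) * B (Φ (f a) (f b)) (Φ (f c) (f d)) :=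
    fun a c => (Q.restrict (compl Q 𝔨)).sum_bilin_self_eq hPn hsn e he f hf
      (B.compl₁₂ (Φ (f a)) (Φ (f c)))
  calc _ = ∑ i, ∑ j, B (Φ (e i) (e j)) (Φ (e i) (e j)) := by simp only [h1]; rfl
    _ = ∑ a, ∑ c, ∑ b, ∑ d, Q.form (Ring.inverse Pn (f a)) (f c) *
        (Q.form (Ring.inverse Pn (f b)) (f d) * B (Φ (f a) (f b)) (Φ (f c) (f d))) := by
      rw [Finset.sum_comm, Finset.sum_congr rfl fun j _ => h2 (e j), Finset.sum_comm]
      refine Finset.sum_congr rfl fun a _ => ?_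
      rw [Finset.sum_comm]
      refine Finset.sum_congr rfl fun c _ => ?_
      rw [← Finset.mul_sum, h3]
      simp only [Finset.mul_sum]
    _ = _ := by
      refine Finset.sum_congr rfl fun a _ => ?_
      rw [Finset.sum_comm]
      simp only [mul_assoc]
      rfl

/-- The theorem in purely Lie-algebraic form: the group enters only through `hQ` and `hinv`, the
infinitesimal versions of `Ad`-invariance. -/
theorem tendsto_scal_of_collapse
    (hQ : ∀ X Y Z : 𝔤, Q.form ⁅X, Y⁆ Z = -Q.form Y ⁅X, Z⁆) (h𝔨 : 𝔥 ≤ 𝔨)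
    (hlie : ∀ X ∈ 𝔨, ∀ Y ∈ 𝔨, ⁅X, Y⁆ ∈ 𝔥)
    {P : ℕ → Module.End ℝ (compl Q 𝔥)} {Pt : ℕ → Module.End ℝ (vertical Q 𝔥 𝔨)}
    {Pn : ℕ → Module.End ℝ (compl Q 𝔨)} {P' : Module.End ℝ (compl Q 𝔨)}
    (hs : ∀ n, ∀ X Y : compl Q 𝔥, Q.form (P n X) Y = Q.form X (P n Y))
    (hpos : ∀ n, ∀ X : compl Q 𝔥, X ≠ 0 → 0 < Q.form (P n X) X)
    (hP' : ∀ X : compl Q 𝔨, X ≠ 0 → 0 < Q.form (P' X) X)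
    (hPt : ∀ n X, P n (Submodule.inclusion vertical_le X) =
      Submodule.inclusion vertical_le (Pt n X))
    (hPn : ∀ n X, P n (Submodule.inclusion (compl_le h𝔨) X) =
      Submodule.inclusion (compl_le h𝔨) (Pn n X))
    (hinv : ∀ n, ∀ X ∈ 𝔨, ∀ Y Z : compl Q 𝔨,
      Q.form ⁅X, (Y : 𝔤)⁆ (Pn n Z) = -Q.form ⁅X, (Z : 𝔤)⁆ (Pn n Y))
    (hfibre : ∀ X, (Q.restrict (vertical Q 𝔥 𝔨)).VecTendsto (fun n => Pt n X) 0)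
    (hbase : ∀ X, (Q.restrict (compl Q 𝔨)).VecTendsto (fun n => Pn n X) (P' X)) :
    Tendsto (fun n => scal Q 𝔥 (P n)) atTop (𝓝 (scal Q 𝔨 P')) := by
  have hcPt : ∀ n X, (P n (Submodule.inclusion vertical_le X) : 𝔤) = Pt n X := fun n X =>
    congrArg Subtype.val (hPt n X)
  have hcPn : ∀ n X, (P n (Submodule.inclusion (compl_le h𝔨) X) : 𝔤) = Pn n X := fun n X =>
    congrArg Subtype.val (hPn n X)
  have hst : ∀ n, ∀ X Y : vertical Q 𝔥 𝔨, Q.form (Pt n X) Y = Q.form X (Pt n Y) := fun n X Y => by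
    have := hs n (Submodule.inclusion vertical_le X) (Submodule.inclusion vertical_le Y)
    rwa [hcPt, hcPt] at this
  have hsn : ∀ n, ∀ X Y : compl Q 𝔨, Q.form (Pn n X) Y = Q.form X (Pn n Y) := fun n X Y => by
    have := hs n (Submodule.inclusion (compl_le h𝔨) X) (Submodule.inclusion (compl_le h𝔨) Y)
    rwa [hcPn, hcPn] at this
  have hpt : ∀ n, ∀ X : vertical Q 𝔥 𝔨, X ≠ 0 → 0 < Q.form (Pt n X) X := fun n X hX => by
    have := hpos n (Submodule.inclusion vertical_le X) fun h =>
      hX (Submodule.inclusion_injective _ (h.trans (map_zero _).symm))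
    rwa [hcPt] at this
  have hpn : ∀ n, ∀ X : compl Q 𝔨, X ≠ 0 → 0 < Q.form (Pn n X) X := fun n X hX => by
    have := hpos n (Submodule.inclusion (compl_le h𝔨) X) fun h =>
      hX (Submodule.inclusion_injective _ (h.trans (map_zero _).symm))
    rwa [hcPn] at this
  have hu : ∀ n, IsUnit (P n) := fun n => isUnit_of_form_pos (Q.restrict _).form _ (hpos n)
  have hun : ∀ n, IsUnit (Pn n) := fun n => isUnit_of_form_pos (Q.restrict _).form _ (hpn n)
  have hu' : IsUnit P' := isUnit_of_form_pos (Q.restrict _).form _ hP'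
  obtain ⟨f, hf⟩ := (Q.restrict (compl Q 𝔨)).exists_orthonormal_basis
  -- The adapted orthonormal bases change with `n` and need not converge, so the correction is
  -- rewritten in the fixed basis `f`.
  have heq : ∀ n, scal Q 𝔥 (P n) = scal Q 𝔨 (Pn n) - 1 / 4 *
      ∑ a, ∑ b, ∑ c, ∑ d, Q.form (Ring.inverse (Pn n) (f a)) (f c)
        * Q.form (Ring.inverse (Pn n) (f b)) (f d)
        * Q.form (Pt n (Q.proj _ ⁅(f a : 𝔤), (f b : 𝔤)⁆))
          (Q.proj (vertical Q 𝔥 𝔨) ⁅(f c : 𝔤), (f d : 𝔤)⁆) := fun n => by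
    obtain ⟨g, hg⟩ :=
      ((Q.restrict (vertical Q 𝔥 𝔨)).ofEnd (Pt n) (hst n) (hpt n)).exists_orthonormal_basis
    obtain ⟨e, he⟩ :=
      ((Q.restrict (compl Q 𝔨)).ofEnd (Pn n) (hsn n) (hpn n)).exists_orthonormal_basis
    have hg' : ∀ i j, Q.form (g i) (Pt n (g j)) = if i = j then 1 else 0 := fun i j => by
      rw [← hst]; exact hg i j
    have he' : ∀ i j, Q.form (e i) (Pn n (e j)) = if i = j then 1 else 0 := fun i j => by
      rw [← hsn]; exact he i j
    rw [scal_eq_scal_base_sub_sum hQ h𝔨 hlie (hu n) (hun n) (hs n) (hsn n) (hPt n) (hPn n)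
      (hinv n) g e hg' he', sum_form_lie_sq_eq (hun n) (hst n) (hsn n) g e hg' he' f hf]
  have hinvlim := EuclideanForm.VecTendsto.inverse hun hu' hbase
  have hsum : Tendsto (fun n => ∑ a, ∑ b, ∑ c, ∑ d, Q.form (Ring.inverse (Pn n) (f a)) (f c)
        * Q.form (Ring.inverse (Pn n) (f b)) (f d)
        * Q.form (Pt n (Q.proj _ ⁅(f a : 𝔤), (f b : 𝔤)⁆))
          (Q.proj (vertical Q 𝔥 𝔨) ⁅(f c : 𝔤), (f d : 𝔤)⁆)) atTop (𝓝 0) := by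
    have h0 : ∀ u v : vertical Q 𝔥 𝔨, Tendsto (fun n => Q.form (Pt n u) v) atTop (𝓝 0) :=
      fun u v => by simpa using hfibre u v
    have h1 : ∀ u v : compl Q 𝔨, Tendsto (fun n => Q.form (Ring.inverse (Pn n) u) v) atTop
      (𝓝 (Q.form (Ring.inverse P' u) v)) := hinvlim
    have := tendsto_finsetSum Finset.univ fun a _ => tendsto_finsetSum Finset.univ fun b _ =>
      tendsto_finsetSum Finset.univ fun c _ => tendsto_finsetSum Finset.univ fun d _ =>
        ((h1 (f a) (f c)).mul (h1 (f b) (f d))).mul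
          (h0 (Q.proj _ ⁅(f a : 𝔤), (f b : 𝔤)⁆) (Q.proj _ ⁅(f c : 𝔤), (f d : 𝔤)⁆))
    simpa using this
  have := (tendsto_scal hun hu' hbase).sub (hsum.const_mul (1 / 4))
  rw [mul_zero, sub_zero] at this
  exact this.congr fun n => (heq n).symm

end HomogeneousMetric

namespace LieGroupChart

/-! ### The adjoint representation in the chart at the identity -/

section

variable {E : Type*} [NormedAddCommGroup E] [NormedSpace ℝ E]
  {G : Type*} [TopologicalSpace G] [ChartedSpace E G] [Group G]

variable (E) in
/-- The multiplication of `G` in the chart at the identity. -/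
def mulChart (G : Type*) [TopologicalSpace G] [ChartedSpace E G] [Group G] (z : E × E) : E :=
  extChartAt 𝓘(ℝ, E) (1 : G)
    ((extChartAt 𝓘(ℝ, E) (1 : G)).symm z.1 * (extChartAt 𝓘(ℝ, E) (1 : G)).symm z.2)

variable (E G) in
/-- The coordinates of the identity. -/
def oneChart : E := extChartAt 𝓘(ℝ, E) (1 : G) 1

variable (E) in
/-- The derivative of the chart at the identity. -/
def chartD (a : G) : E →L[ℝ] E := mfderiv 𝓘(ℝ, E) 𝓘(ℝ, E) (extChartAt 𝓘(ℝ, E) (1 : G)) a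

variable (E) in
/-- The derivative at the identity of the left translation. -/
def leftD (a : G) : E →L[ℝ] E := mfderiv 𝓘(ℝ, E) 𝓘(ℝ, E) (fun x : G => a * x) 1

variable (E) in
/-- The derivative at the identity of the right translation. -/
def rightD (a : G) : E →L[ℝ] E := mfderiv 𝓘(ℝ, E) 𝓘(ℝ, E) (fun x : G => x * a) 1

variable (E) in
/-- The adjoint representation, on the model space. -/
def adD (a : G) : E →L[ℝ] E := mfderiv 𝓘(ℝ, E) 𝓘(ℝ, E) (fun x : G => a * x * a⁻¹) 1

theorem symm_oneChart : (extChartAt 𝓘(ℝ, E) (1 : G)).symm (oneChart E G) = 1 :=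
  extChartAt_to_inv (I := 𝓘(ℝ, E)) (1 : G)

theorem oneChart_mem_target : oneChart E G ∈ (extChartAt 𝓘(ℝ, E) (1 : G)).target :=
  mem_extChartAt_target (I := 𝓘(ℝ, E)) (1 : G)

theorem target_mem_nhds : (extChartAt 𝓘(ℝ, E) (1 : G)).target ∈ 𝓝 (oneChart E G) :=
  extChartAt_target_mem_nhds (I := 𝓘(ℝ, E)) (1 : G)

end

variable {E : Type*} [NormedAddCommGroup E] [NormedSpace ℝ E]
  {G : Type*} [TopologicalSpace G] [ChartedSpace E G] [Group G] [LieGroup 𝓘(ℝ, E) ∞ G]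

omit [Group G] [LieGroup 𝓘(ℝ, E) ∞ G] in
theorem mdifferentiable_of_contMDiff {f : G → G} (hf : ContMDiff 𝓘(ℝ, E) 𝓘(ℝ, E) ∞ f) :
    MDifferentiable 𝓘(ℝ, E) 𝓘(ℝ, E) f := hf.mdifferentiable (by simp)

theorem hasMFDerivAt_left (a : G) :
    HasMFDerivAt 𝓘(ℝ, E) 𝓘(ℝ, E) (fun x : G => a * x) 1 (leftD E a) :=
  (mdifferentiable_of_contMDiff contMDiff_mul_left 1).hasMFDerivAt

theorem hasMFDerivAt_right (a : G) :
    HasMFDerivAt 𝓘(ℝ, E) 𝓘(ℝ, E) (fun x : G => x * a) 1 (rightD E a) :=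
  (mdifferentiable_of_contMDiff contMDiff_mul_right 1).hasMFDerivAt

theorem contMDiff_conj (a : G) : ContMDiff 𝓘(ℝ, E) 𝓘(ℝ, E) ∞ (fun x : G => a * x * a⁻¹) :=
  contMDiff_mul_right.comp contMDiff_mul_left

theorem hasMFDerivAt_conj (a : G) :
    HasMFDerivAt 𝓘(ℝ, E) 𝓘(ℝ, E) (fun x : G => a * x * a⁻¹) 1 (adD E a) :=
  (mdifferentiable_of_contMDiff (contMDiff_conj a) 1).hasMFDerivAt

theorem hasMFDerivAt_chart {a : G} (ha : a ∈ (extChartAt 𝓘(ℝ, E) (1 : G)).source) :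
    HasMFDerivAt 𝓘(ℝ, E) 𝓘(ℝ, E) (extChartAt 𝓘(ℝ, E) (1 : G)) a (chartD E a) :=
  (mdifferentiableAt_extChartAt (I := 𝓘(ℝ, E)) (by simpa using ha)).hasMFDerivAt

omit [Group G] [LieGroup 𝓘(ℝ, E) ∞ G] in
theorem hasMFDerivAt_congr_point {f : G → G} {x y : G} (h : x = y) {f' : E →L[ℝ] E}
    (hf : HasMFDerivAt 𝓘(ℝ, E) 𝓘(ℝ, E) f x f') : HasMFDerivAt 𝓘(ℝ, E) 𝓘(ℝ, E) f y f' := by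
  subst h; exact hf

theorem hasMFDerivAt_symm : HasMFDerivAt 𝓘(ℝ, E) 𝓘(ℝ, E)
    (extChartAt 𝓘(ℝ, E) (1 : G)).symm (oneChart E G) (ContinuousLinearMap.id ℝ E) := by
  have h1 := mdifferentiableWithinAt_extChartAt_symm (I := 𝓘(ℝ, E)) (x := (1 : G))
    oneChart_mem_target
  have h2 := mfderivWithin_range_extChartAt_symm (I := 𝓘(ℝ, E)) (x := (1 : G))
  have h3 := h1.hasMFDerivWithinAt
  have h4 := h3.hasMFDerivAt (by simp)
  exact h2 ▸ h4

/-- Differentiate `a x = (a x a⁻¹) a` at `x = 1`. -/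
theorem leftD_eq (a : G) : leftD E a = (rightD E a).comp (adD E a) := by
  have h1 : HasMFDerivAt 𝓘(ℝ, E) 𝓘(ℝ, E) (fun x : G => x * a) (a * 1 * a⁻¹) (rightD E a) :=
    hasMFDerivAt_congr_point (by simp) (hasMFDerivAt_right a)
  have h2 := HasMFDerivAt.comp (1 : G) h1 (hasMFDerivAt_conj a)
  have h3 : (fun x : G => x * a) ∘ (fun x : G => a * x * a⁻¹) = fun x => a * x := by
    ext x; simp
  rw [h3] at h2
  exact hasMFDerivAt_unique (hasMFDerivAt_left a) h2

theorem contDiffAt_mulChart :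
    ContDiffAt ℝ ∞ (mulChart E G) (oneChart E G, oneChart E G) := by
  have hs : ContMDiffAt 𝓘(ℝ, E) 𝓘(ℝ, E) ∞ (extChartAt 𝓘(ℝ, E) (1 : G)).symm (oneChart E G) :=
    haveI : IsManifold 𝓘(ℝ, E) ∞ G := ContMDiffMul.toIsManifold
    (contMDiffOn_extChartAt_symm (1 : G)).contMDiffAt target_mem_nhds
  have h1 : ContMDiffAt 𝓘(ℝ, E × E) 𝓘(ℝ, E) ∞
      (fun z : E × E => (extChartAt 𝓘(ℝ, E) (1 : G)).symm z.1) (oneChart E G, oneChart E G) :=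
    ContMDiffAt.comp (oneChart E G, oneChart E G) hs contDiff_fst.contMDiff.contMDiffAt
  have h2 : ContMDiffAt 𝓘(ℝ, E × E) 𝓘(ℝ, E) ∞
      (fun z : E × E => (extChartAt 𝓘(ℝ, E) (1 : G)).symm z.2) (oneChart E G, oneChart E G) :=
    ContMDiffAt.comp (oneChart E G, oneChart E G) hs contDiff_snd.contMDiff.contMDiffAt
  have h3 := h1.mul h2
  have h4 : ContMDiffAt 𝓘(ℝ, E) 𝓘(ℝ, E) ∞ (extChartAt 𝓘(ℝ, E) (1 : G)) 1 := 
    haveI : IsManifold 𝓘(ℝ, E) ∞ G := ContMDiffMul.toIsManifold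
    contMDiffAt_extChartAt
  have h5 := ContMDiffAt.comp_of_eq h4 h3 (by
    change (extChartAt 𝓘(ℝ, E) (1 : G)).symm (oneChart E G) *
      (extChartAt 𝓘(ℝ, E) (1 : G)).symm (oneChart E G) = 1
    rw [symm_oneChart, one_mul])
  exact h5.contDiffAt

theorem eventually_hasFDerivAt_mulChart :
    ∀ᶠ z in 𝓝 (oneChart E G, oneChart E G),
      HasFDerivAt (mulChart E G) (fderiv ℝ (mulChart E G) z) z := by
  have h := (contDiffAt_mulChart (E := E) (G := G)).of_le (m := 1) (by exact_mod_cast le_top)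
  filter_upwards [h.eventually (by simp)] with z hz
  exact (hz.differentiableAt (by simp)).hasFDerivAt

/-- With the first factor frozen at `a`, the chart multiplication is left translation by `a` read in
the chart; the chart inverse has derivative the identity at the base point. -/
theorem fderiv_mulChart_left {x : E} (hx : x ∈ (extChartAt 𝓘(ℝ, E) (1 : G)).target)
    (hd : HasFDerivAt (mulChart E G) (fderiv ℝ (mulChart E G) (x, oneChart E G)) (x, oneChart E G))
    (v : E) : fderiv ℝ (mulChart E G) (x, oneChart E G) (0, v) =
      chartD E ((extChartAt 𝓘(ℝ, E) (1 : G)).symm x)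
        (leftD E ((extChartAt 𝓘(ℝ, E) (1 : G)).symm x) v) := by
  set a := (extChartAt 𝓘(ℝ, E) (1 : G)).symm x with ha
  have h1 := hasMFDerivAt_congr_point (symm_oneChart (E := E)).symm (hasMFDerivAt_left (E := E) a)
  have h2 := HasMFDerivAt.comp (oneChart E G) h1 hasMFDerivAt_symm
  have h3 : HasMFDerivAt 𝓘(ℝ, E) 𝓘(ℝ, E) (extChartAt 𝓘(ℝ, E) (1 : G))
      (((fun y : G => a * y) ∘ (extChartAt 𝓘(ℝ, E) (1 : G)).symm) (oneChart E G)) (chartD E a) := by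
    have : ((fun y : G => a * y) ∘ (extChartAt 𝓘(ℝ, E) (1 : G)).symm) (oneChart E G) = a := by
      rw [Function.comp_apply, symm_oneChart, mul_one]
    rw [this]
    exact hasMFDerivAt_chart ((extChartAt 𝓘(ℝ, E) (1 : G)).map_target hx)
  have h4 := (HasMFDerivAt.comp (oneChart E G) h3 h2).hasFDerivAt
  have h5 := HasFDerivAt.comp (oneChart E G) hd
    ((hasFDerivAt_const x (oneChart E G)).prodMk (hasFDerivAt_id (oneChart E G)))
  have h6 := h5.unique h4
  exact congrArg (fun T : E →L[ℝ] E => T v) h6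

theorem fderiv_mulChart_right {x : E} (hx : x ∈ (extChartAt 𝓘(ℝ, E) (1 : G)).target)
    (hd : HasFDerivAt (mulChart E G) (fderiv ℝ (mulChart E G) (oneChart E G, x)) (oneChart E G, x))
    (v : E) : fderiv ℝ (mulChart E G) (oneChart E G, x) (v, 0) =
      chartD E ((extChartAt 𝓘(ℝ, E) (1 : G)).symm x)
        (rightD E ((extChartAt 𝓘(ℝ, E) (1 : G)).symm x) v) := by
  set a := (extChartAt 𝓘(ℝ, E) (1 : G)).symm x with ha
  have h1 := hasMFDerivAt_congr_point (symm_oneChart (E := E)).symm (hasMFDerivAt_right (E := E) a)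
  have h2 := HasMFDerivAt.comp (oneChart E G) h1 hasMFDerivAt_symm
  have h3 : HasMFDerivAt 𝓘(ℝ, E) 𝓘(ℝ, E) (extChartAt 𝓘(ℝ, E) (1 : G))
      (((fun y : G => y * a) ∘ (extChartAt 𝓘(ℝ, E) (1 : G)).symm) (oneChart E G)) (chartD E a) := by
    have : ((fun y : G => y * a) ∘ (extChartAt 𝓘(ℝ, E) (1 : G)).symm) (oneChart E G) = a := by
      rw [Function.comp_apply, symm_oneChart, one_mul]
    rw [this]
    exact hasMFDerivAt_chart ((extChartAt 𝓘(ℝ, E) (1 : G)).map_target hx)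
  have h4 := (HasMFDerivAt.comp (oneChart E G) h3 h2).hasFDerivAt
  have h5 := HasFDerivAt.comp (f := fun y : E => (y, x)) (oneChart E G) hd
    ((hasFDerivAt_id (𝕜 := ℝ) (oneChart E G)).prodMk (hasFDerivAt_const x (oneChart E G)))
  have h6 := h5.unique h4
  exact congrArg (fun T : E →L[ℝ] E => T v) h6

/-- The left-invariant vector field of `v`, in the chart at the identity. -/
def leftField (G : Type*) [TopologicalSpace G] [ChartedSpace E G] [Group G] (v x : E) : E :=
  fderiv ℝ (mulChart E G) (x, oneChart E G) (0, v)

/-- The Lie bracket of the group is defined through such pullbacks, so this makes it computable from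
the second derivative of `mulChart`. -/
theorem mpullbackWithin_eventuallyEq (v : GroupLieAlgebra 𝓘(ℝ, E) G) :
    VectorField.mpullbackWithin 𝓘(ℝ, E) 𝓘(ℝ, E) (extChartAt 𝓘(ℝ, E) (1 : G)).symm
      (mulInvariantVectorField v) (Set.range 𝓘(ℝ, E)) =ᶠ[𝓝 (oneChart E G)] leftField G v := by
  have hcont : ContinuousAt (fun x : E => (x, oneChart E G)) (oneChart E G) := by fun_prop
  filter_upwards [target_mem_nhds (G := G), hcont.eventually eventually_hasFDerivAt_mulChart]
    with x hx hd
  have h1 := mfderiv_extChartAt_comp_mfderivWithin_extChartAt_symm (I := 𝓘(ℝ, E)) hx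
  have h2 := mfderivWithin_extChartAt_symm_comp_mfderiv_extChartAt (I := 𝓘(ℝ, E)) hx
  have h3 := ContinuousLinearMap.inverse_eq h2 h1
  rw [VectorField.mpullbackWithin_apply, h3]
  exact (fderiv_mulChart_left hx hd v).symm

theorem chartD_one : chartD E (1 : G) = ContinuousLinearMap.id ℝ E :=
  mfderiv_extChartAt_self (I := 𝓘(ℝ, E)) (x := (1 : G))

omit [LieGroup 𝓘(ℝ, E) ∞ G] in
theorem leftD_one : leftD E (1 : G) = ContinuousLinearMap.id ℝ E := by
  have h : (fun x : G => 1 * x) = id := by ext x; simp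
  rw [leftD, h]
  exact mfderiv_id

omit [LieGroup 𝓘(ℝ, E) ∞ G] in
theorem rightD_one : rightD E (1 : G) = ContinuousLinearMap.id ℝ E := by
  have h : (fun x : G => x * 1) = id := by ext x; simp
  rw [rightD, h]
  exact mfderiv_id

theorem lie_eq_lieBracket [LieGroup 𝓘(ℝ, E) (minSmoothness ℝ 3) G]
    (X Y : GroupLieAlgebra 𝓘(ℝ, E) G) :
    ⁅X, Y⁆ = VectorField.lieBracket ℝ (leftField (E := E) G X) (leftField (E := E) G Y) (oneChart E G) := by
  have hinv : ∀ w : E, (chartD E (1 : G)).inverse w = w := fun w => by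
    rw [chartD_one, ContinuousLinearMap.inverse_id]; rfl
  have hset : (extChartAt 𝓘(ℝ, E) (1 : G)).symm ⁻¹' Set.univ ∩ Set.range 𝓘(ℝ, E) = Set.univ := by
    simp
  have key : ∀ V W : E → E, V =ᶠ[𝓝 (oneChart E G)] leftField (E := E) G X →
      W =ᶠ[𝓝 (oneChart E G)] leftField (E := E) G Y →
      (chartD E (1 : G)).inverse (VectorField.lieBracketWithin ℝ V W
        ((extChartAt 𝓘(ℝ, E) (1 : G)).symm ⁻¹' Set.univ ∩ Set.range 𝓘(ℝ, E)) (oneChart E G)) =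
      VectorField.lieBracket ℝ (leftField (E := E) G X) (leftField (E := E) G Y) (oneChart E G) :=
    fun V W hV hW => by
      rw [hinv, hset, VectorField.lieBracketWithin_univ, hV.lieBracket_vectorField_eq hW]
  exact key (VectorField.mpullbackWithin 𝓘(ℝ, E) 𝓘(ℝ, E) (extChartAt 𝓘(ℝ, E) (1 : G)).symm
      (mulInvariantVectorField X) (Set.range 𝓘(ℝ, E)))
    (VectorField.mpullbackWithin 𝓘(ℝ, E) 𝓘(ℝ, E) (extChartAt 𝓘(ℝ, E) (1 : G)).symm
      (mulInvariantVectorField Y) (Set.range 𝓘(ℝ, E)))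
    (mpullbackWithin_eventuallyEq X) (mpullbackWithin_eventuallyEq Y)

/-- Write `μ` for the chart multiplication and `p` for the coordinates of `1`. Comparing left and
right translations gives `∂₁μ(p, x) (Ad(x) v) = ∂₂μ(x, p) v`. Differentiating at `p` in direction
`w` expresses the derivative of `Ad` as a difference of mixed second derivatives of `μ`. By their
symmetry this is the bracket of the left-invariant fields. -/
theorem exists_hasFDerivAt_adD [CompleteSpace E] (v : E) : ∃ L : E →L[ℝ] E,
    HasFDerivAt (fun x => adD E ((extChartAt 𝓘(ℝ, E) (1 : G)).symm x) v) L (oneChart E G) ∧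
    ∀ w, L w = VectorField.lieBracket ℝ (leftField G w) (leftField G v) (oneChart E G) := by
  set p := oneChart E G with hp
  set D := fderiv ℝ (mulChart E G) with hD
  have hC : ContDiffAt ℝ 2 (mulChart E G) (p, p) :=
    contDiffAt_mulChart.of_le (n := ∞) ENat.LEInfty.out
  have hD1 : HasFDerivAt D (fderiv ℝ D (p, p)) (p, p) :=
    (hC.fderiv_right (m := 1) (by norm_num)).differentiableAt (by simp) |>.hasFDerivAt
  have hsymm : IsSymmSndFDerivAt ℝ (mulChart E G) (p, p) :=
    hC.isSymmSndFDerivAt (by simp)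
  have hl : ∀ u : E, HasFDerivAt (fun x => D (x, p) (0, u))
      ((ContinuousLinearMap.apply ℝ E ((0, u) : E × E)).comp
        ((fderiv ℝ D (p, p)).comp ((ContinuousLinearMap.id ℝ E).prod 0))) p := fun u =>
    (ContinuousLinearMap.apply ℝ E ((0, u) : E × E)).hasFDerivAt.comp p
      (HasFDerivAt.comp (f := fun x : E => (x, p)) p hD1
        ((hasFDerivAt_id (𝕜 := ℝ) p).prodMk (hasFDerivAt_const p p)))
  have hl' : ∀ u w : E, fderiv ℝ (leftField G u) p w = fderiv ℝ D (p, p) (w, 0) (0, u) :=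
    fun u w => congrArg (fun T : E →L[ℝ] E => T w) (hl u).fderiv
  set T : E → (E →L[ℝ] E) := fun x => (D (p, x)).comp (ContinuousLinearMap.inl ℝ E E) with hT
  have hr : HasFDerivAt T (((ContinuousLinearMap.compL ℝ E (E × E) E).flip
      (ContinuousLinearMap.inl ℝ E E)).comp
        ((fderiv ℝ D (p, p)).comp ((0 : E →L[ℝ] E).prod (ContinuousLinearMap.id ℝ E)))) p :=
    ((ContinuousLinearMap.compL ℝ E (E × E) E).flip
      (ContinuousLinearMap.inl ℝ E E)).hasFDerivAt.comp p
      (HasFDerivAt.comp (f := fun x : E => (p, x)) p hD1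
        ((hasFDerivAt_const p p).prodMk (hasFDerivAt_id (𝕜 := ℝ) p)))
  have hone : ∀ u : E, D (p, p) (u, 0) = u ∧ D (p, p) (0, u) = u := by
    intro u
    have h0 := (eventually_hasFDerivAt_mulChart (E := E) (G := G)).self_of_nhds
    have h1 := fderiv_mulChart_left oneChart_mem_target h0 u
    have h2 := fderiv_mulChart_right oneChart_mem_target h0 u
    rw [symm_oneChart, chartD_one] at h1 h2
    rw [leftD_one] at h1
    rw [rightD_one] at h2
    exact ⟨h2, h1⟩
  have hTp : T p = 1 := by
    ext u
    exact (hone u).1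
  have hcl : ContinuousAt (fun x : E => (x, p)) p := by fun_prop
  have hcr : ContinuousAt (fun x : E => (p, x)) p := by fun_prop
  have hev : ∀ᶠ x in 𝓝 p, T x (adD E ((extChartAt 𝓘(ℝ, E) (1 : G)).symm x) v) = D (x, p) (0, v) := by
    filter_upwards [target_mem_nhds (E := E) (G := G),
      hcl.eventually eventually_hasFDerivAt_mulChart,
      hcr.eventually eventually_hasFDerivAt_mulChart] with x hx hdl hdr
    rw [fderiv_mulChart_left hx hdl, leftD_eq]
    exact fderiv_mulChart_right hx hdr _
  have hunit : ∀ᶠ x in 𝓝 p, IsUnit (T x) := by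
    refine hr.continuousAt.eventually (Units.isOpen.mem_nhds ?_)
    rw [hTp]; exact isUnit_one
  set g : E → E := fun x => adD E ((extChartAt 𝓘(ℝ, E) (1 : G)).symm x) v with hg
  -- Near `p` the operator `T x` is invertible, because `T p = 1`; solving `hev` for `Ad` gives its
  -- differentiability.
  have hgd : DifferentiableAt ℝ g p := by
    have h1 : DifferentiableAt ℝ (fun x => Ring.inverse (T x) (D (x, p) (0, v))) p :=
      (hr.differentiableAt.inverse (by rw [hTp]; exact isUnit_one)).clm_apply
        (hl v).differentiableAt
    refine h1.congr_of_eventuallyEq ?_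
    filter_upwards [hev, hunit] with x hx hu
    have := congrArg (fun S : E →L[ℝ] E => S (g x)) (Ring.inverse_mul_cancel (T x) hu)
    rw [← hx]
    exact this.symm
  refine ⟨fderiv ℝ g p, hgd.hasFDerivAt, fun w => ?_⟩
  have hgp : g p = v := by
    have := hev.self_of_nhds
    rw [hTp, (hone v).2] at this
    exact this
  have h1 := hr.clm_apply hgd.hasFDerivAt
  have h2 := (h1.congr_of_eventuallyEq (hev.mono fun x hx => hx.symm)).unique (hl v)
  have h3 := congrArg (fun S : E →L[ℝ] E => S w) h2
  simp only [hTp, hgp] at h3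
  -- The product rule for the identity `hev` in direction `w`, with `T p = 1` and `g p = v`.
  have h4 : fderiv ℝ g p w + fderiv ℝ D (p, p) (0, w) (v, 0) = fderiv ℝ D (p, p) (w, 0) (0, v) := by
    simpa using h3
  have h5 : fderiv ℝ D (p, p) (0, w) (v, 0) = fderiv ℝ D (p, p) (v, 0) (0, w) := hsymm _ _
  have h6 : leftField G v p = v := (hone v).2
  have h7 : leftField G w p = w := (hone w).2
  rw [VectorField.lieBracket_eq]
  simp only [h6, h7, hl', ← h5, ← h4, add_sub_cancel_right]

end LieGroupChart

/-! ### One-parameter subgroups, and passage from `Ad` to `ad` -/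

namespace LieGroupChart

variable {E : Type*} [NormedAddCommGroup E] [NormedSpace ℝ E]
  {G : Type*} [TopologicalSpace G] [ChartedSpace E G] [Group G] [LieGroup 𝓘(ℝ, E) ∞ G]

omit [LieGroup 𝓘(ℝ, E) ∞ G] in
theorem adD_one : adD E (1 : G) = ContinuousLinearMap.id ℝ E := by
  have h : (fun x : G => 1 * x * 1⁻¹) = id := by ext x; simp
  rw [adD, h]
  exact mfderiv_id

theorem adD_mul (a b : G) : adD E (a * b) = (adD E a).comp (adD E b) := by
  have h1 : HasMFDerivAt 𝓘(ℝ, E) 𝓘(ℝ, E) (fun x : G => a * x * a⁻¹) (b * 1 * b⁻¹) (adD E a) :=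
    hasMFDerivAt_congr_point (by simp) (hasMFDerivAt_conj a)
  have h2 := HasMFDerivAt.comp (1 : G) h1 (hasMFDerivAt_conj b)
  have h3 : (fun x : G => a * x * a⁻¹) ∘ (fun x : G => b * x * b⁻¹) =
      fun x => (a * b) * x * (a * b)⁻¹ := by
    ext x; simp [mul_assoc]
  rw [h3] at h2
  exact hasMFDerivAt_unique (hasMFDerivAt_conj (a * b)) h2

/-- Left translations preserve the integral curves of left-invariant vector fields. -/
theorem isMIntegralCurveOn_mul_left {X : GroupLieAlgebra 𝓘(ℝ, E) G} {γ : ℝ → G} {s : Set ℝ}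
    (hγ : IsMIntegralCurveOn γ (mulInvariantVectorField (I := 𝓘(ℝ, E)) X) s) (a : G) :
    IsMIntegralCurveOn (fun t => a * γ t) (mulInvariantVectorField (I := 𝓘(ℝ, E)) X) s := by
  intro t ht
  have h1 : HasMFDerivAt 𝓘(ℝ, E) 𝓘(ℝ, E) (fun x : G => a * x) (γ t)
      (mfderiv 𝓘(ℝ, E) 𝓘(ℝ, E) (fun x : G => a * x) (γ t)) :=
    (mdifferentiable_of_contMDiff contMDiff_mul_left _).hasMFDerivAt
  have h2 := HasMFDerivAt.comp_hasMFDerivWithinAt t h1 (hγ t ht)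
  have h3 : HasMFDerivAt 𝓘(ℝ, E) 𝓘(ℝ, E) (fun x : G => a * x) (γ t * 1)
      (mfderiv 𝓘(ℝ, E) 𝓘(ℝ, E) (fun x : G => a * x) (γ t) : E →L[ℝ] E) :=
    hasMFDerivAt_congr_point (mul_one _).symm h1
  have h4 := HasMFDerivAt.comp (1 : G) h3 (hasMFDerivAt_left (γ t))
  have h5 : (fun x : G => a * x) ∘ (fun x : G => γ t * x) = fun x => (a * γ t) * x := by
    ext x; simp [mul_assoc]
  rw [h5] at h4
  have h6 := hasMFDerivAt_unique (hasMFDerivAt_left (a * γ t)) h4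
  have h7 : mulInvariantVectorField (I := 𝓘(ℝ, E)) X (a * γ t) =
      mfderiv 𝓘(ℝ, E) 𝓘(ℝ, E) (fun x : G => a * x) (γ t)
        (mulInvariantVectorField (I := 𝓘(ℝ, E)) X (γ t)) :=
    congrArg (fun T : E →L[ℝ] E => T X) h6
  rw [h7]
  have h8 : ∀ (T : E →L[ℝ] E) (v : E), (1 : ℝ →L[ℝ] ℝ).smulRight (T v) =
      T.comp ((1 : ℝ →L[ℝ] ℝ).smulRight v) := fun T v => by
    ext; simp
  exact h2.congr_mfderiv (h8 _ _).symm

omit [LieGroup 𝓘(ℝ, E) ∞ G] in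
theorem exists_continuousLinearMap [FiniteDimensional ℝ E]
    (ℓ : GroupLieAlgebra 𝓘(ℝ, E) G →ₗ[ℝ] ℝ) : ∃ m : E →L[ℝ] ℝ, ∀ x : E, m x = ℓ x :=
  let m : E →ₗ[ℝ] ℝ := ℓ
  ⟨m.toContinuousLinearMap, fun _ => rfl⟩

variable [FiniteDimensional ℝ E]

/-- A local integral curve through `1`, left translated, gives integral curves through every point
with the same existence time, and a uniform existence time yields a global curve. -/
theorem exists_isExpCurve [T2Space G] (X : GroupLieAlgebra 𝓘(ℝ, E) G) :
    ∃ φ : ℝ → G, IsExpCurve X φ := by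
  have : CompleteSpace E := FiniteDimensional.complete ℝ E
  have hv : ContMDiff 𝓘(ℝ, E) 𝓘(ℝ, E).tangent 1 (fun g : G =>
      (⟨g, mulInvariantVectorField (I := 𝓘(ℝ, E)) X g⟩ : TangentBundle 𝓘(ℝ, E) G)) :=
    (contMDiff_mulInvariantVectorField X).of_le (by
      rw [minSmoothness_of_isRCLikeNormedField]; norm_num)
  obtain ⟨γ, hγ0, hγ⟩ := exists_isMIntegralCurveAt_of_contMDiffAt_boundaryless (0 : ℝ)
    (hv.contMDiffAt (x := 1))
  obtain ⟨ε, hε, hγ⟩ := isMIntegralCurveAt_iff'.1 hγ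
  rw [Real.ball_eq_Ioo, zero_sub, zero_add] at hγ
  refine exists_isMIntegralCurve_of_isMIntegralCurveOn hv hε (fun a => ?_) 1
  exact ⟨fun t => a * γ t, by simp [hγ0], isMIntegralCurveOn_mul_left hγ a⟩

omit [FiniteDimensional ℝ E] [LieGroup 𝓘(ℝ, E) ∞ G] in
theorem isExpCurve_comp_mul {X : GroupLieAlgebra 𝓘(ℝ, E) G} {φ : ℝ → G} (hφ : IsExpCurve X φ)
    (c : ℝ) : IsExpCurve (c • X) (fun t => φ (t * c)) := by
  refine ⟨by simpa using hφ.1, ?_⟩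
  rw [mulInvariantVectorField_smul]
  exact hφ.2.comp_mul c

omit [FiniteDimensional ℝ E] in
theorem isExpCurve_translate {X : GroupLieAlgebra 𝓘(ℝ, E) G} {φ : ℝ → G} (hφ : IsExpCurve X φ)
    (t : ℝ) : IsExpCurve X (fun s => (φ t)⁻¹ * φ (s + t)) := by
  refine ⟨by simp, ?_⟩
  rw [isMIntegralCurve_iff_isMIntegralCurveOn]
  exact isMIntegralCurveOn_mul_left ((hφ.2.comp_add t).isMIntegralCurveOn Set.univ) _

theorem hasDerivAt_Ad_zero {X : GroupLieAlgebra 𝓘(ℝ, E) G} {φ : ℝ → G} (hφ : IsExpCurve X φ)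
    (ℓ : GroupLieAlgebra 𝓘(ℝ, E) G →ₗ[ℝ] ℝ) (Y : GroupLieAlgebra 𝓘(ℝ, E) G) :
    HasDerivAt (fun t => ℓ (Ad E (φ t) Y)) (ℓ ⁅X, Y⁆) 0 := by
  have : CompleteSpace E := FiniteDimensional.complete ℝ E
  obtain ⟨L, hL, hLw⟩ := exists_hasFDerivAt_adD (E := E) (G := G) Y
  have h1 : HasMFDerivAt 𝓘(ℝ, ℝ) 𝓘(ℝ, E) φ 0 ((1 : ℝ →L[ℝ] ℝ).smulRight (X : E)) := by
    have h := hφ.2 0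
    have hX : mulInvariantVectorField (I := 𝓘(ℝ, E)) X (φ 0) = (X : E) := by
      rw [hφ.1]
      exact congrArg (fun T : E →L[ℝ] E => T X) leftD_one
    rw [hX] at h
    exact h
  have h2 : HasMFDerivAt 𝓘(ℝ, E) 𝓘(ℝ, E) (extChartAt 𝓘(ℝ, E) (1 : G)) (φ 0)
      (ContinuousLinearMap.id ℝ E) := by
    rw [hφ.1, ← chartD_one (E := E) (G := G)]
    exact hasMFDerivAt_chart (mem_extChartAt_source _)
  have h3 : HasFDerivAt (fun t => extChartAt 𝓘(ℝ, E) (1 : G) (φ t))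
      ((ContinuousLinearMap.id ℝ E).comp ((1 : ℝ →L[ℝ] ℝ).smulRight (X : E))) 0 :=
    (HasMFDerivAt.comp (0 : ℝ) h2 h1).hasFDerivAt
  have h4 : HasFDerivAt (fun x => adD E ((extChartAt 𝓘(ℝ, E) (1 : G)).symm x) Y) L
      (extChartAt 𝓘(ℝ, E) (1 : G) (φ 0)) := by
    rw [hφ.1]; exact hL
  have h5 := h4.comp (0 : ℝ) h3
  obtain ⟨m, hm⟩ := exists_continuousLinearMap ℓ
  have h6 := (m.hasFDerivAt.comp (0 : ℝ) h5).hasDerivAt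
  have hsrc : ∀ᶠ t in 𝓝 (0 : ℝ), φ t ∈ (extChartAt 𝓘(ℝ, E) (1 : G)).source := by
    refine h1.1.eventually ?_
    rw [hφ.1]
    exact extChartAt_source_mem_nhds (I := 𝓘(ℝ, E)) (1 : G)
  have h7 : HasDerivAt (fun t => ℓ (Ad E (φ t) Y)) _ 0 := h6.congr_of_eventuallyEq (by
    filter_upwards [hsrc] with t ht
    simp only [Function.comp_apply, (extChartAt 𝓘(ℝ, E) (1 : G)).left_inv ht]
    exact (hm _).symm)
  have h8 : L X = ⁅X, Y⁆ := (hLw X).trans (lie_eq_lieBracket X Y).symm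
  rw [← h8]
  convert h7 using 1
  simp only [ContinuousLinearMap.comp_apply, ContinuousLinearMap.id_apply, hm]
  exact congrArg (fun w : E => ℓ (L w)) (one_smul ℝ (X : E)).symm

/-- Reduces to time `0`: `(φ t)⁻¹ φ(s + t)` is again an exponential curve of `X`, and `Ad` is
multiplicative. -/
theorem hasDerivAt_Ad {X : GroupLieAlgebra 𝓘(ℝ, E) G} {φ : ℝ → G} (hφ : IsExpCurve X φ)
    (ℓ : GroupLieAlgebra 𝓘(ℝ, E) G →ₗ[ℝ] ℝ) (Y : GroupLieAlgebra 𝓘(ℝ, E) G) (t : ℝ) :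
    HasDerivAt (fun s => ℓ (Ad E (φ s) Y)) (ℓ (Ad E (φ t) ⁅X, Y⁆)) t := by
  have h1 := hasDerivAt_Ad_zero (isExpCurve_translate hφ t) (ℓ ∘ₗ (Ad E (φ t)).toLinearMap) Y
  have h2 : (fun s => (ℓ ∘ₗ (Ad E (φ t)).toLinearMap) (Ad E ((φ t)⁻¹ * φ (s + t)) Y)) =
      fun s => ℓ (Ad E (φ (s + t)) Y) := by
    ext s
    have h3 : Ad E (φ t) (Ad E ((φ t)⁻¹ * φ (s + t)) Y) = Ad E (φ t * ((φ t)⁻¹ * φ (s + t))) Y :=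
      congrArg (fun T : E →L[ℝ] E => T Y) (adD_mul (φ t) ((φ t)⁻¹ * φ (s + t))).symm
    rw [mul_inv_cancel_left] at h3
    exact congrArg ℓ h3
  rw [h2] at h1
  have h4 := (hasDerivAt_id t).sub_const t
  have h5 := HasDerivAt.comp_of_eq (h₂ := fun s => ℓ (Ad E (φ (s + t)) Y)) t h1 h4 (by simp)
  simpa [Function.comp_def] using h5

/-- If `W` is `ad(X)`-invariant, then it is invariant under `Ad(exp(tX))`. -/
theorem apply_Ad_eq_zero {X : GroupLieAlgebra 𝓘(ℝ, E) G} {φ : ℝ → G} (hφ : IsExpCurve X φ)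
    (W : Submodule ℝ (GroupLieAlgebra 𝓘(ℝ, E) G)) (hW : ∀ Y ∈ W, ⁅X, Y⁆ ∈ W)
    (ℓ : GroupLieAlgebra 𝓘(ℝ, E) G →ₗ[ℝ] ℝ) (hℓ : ∀ Y ∈ W, ℓ Y = 0) (t : ℝ) :
    ∀ Y ∈ W, ℓ (Ad E (φ t) Y) = 0 := by
  set b := Module.finBasis ℝ W with hb
  -- The matrix of `ad(X)` on `W`, for which the functions `ℓ(Ad(φ s) b_i)` solve `f' = A f`. They
  -- vanish at `0`, so uniqueness makes them identically zero.
  set A : (Fin (Module.finrank ℝ W) → ℝ) →L[ℝ] (Fin (Module.finrank ℝ W) → ℝ) :=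
    ContinuousLinearMap.pi fun i => ∑ j, b.repr ⟨_, hW _ (b i).2⟩ j •
      ContinuousLinearMap.proj (R := ℝ) (φ := fun _ => ℝ) j with hA
  set f : ℝ → (Fin (Module.finrank ℝ W) → ℝ) := fun s i => ℓ (Ad E (φ s) (b i)) with hf
  have hsum : ∀ (Y : W) (s : ℝ), ℓ (Ad E (φ s) Y) = ∑ j, b.repr Y j * f s j := fun Y s => by
    have h1 := congrArg Subtype.val (b.sum_repr Y)
    simp only [AddSubmonoidClass.coe_finsetSum, Submodule.coe_smul] at h1
    conv_lhs => rw [← h1]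
    simp [hf, map_sum]
  have hderiv : ∀ s, HasDerivAt f (A (f s)) s := fun s => by
    rw [hasDerivAt_pi]
    intro i
    have h1 := hasDerivAt_Ad hφ ℓ (b i) s
    have h2 : A (f s) i = ℓ (Ad E (φ s) ⁅X, (b i : GroupLieAlgebra 𝓘(ℝ, E) G)⁆) := by
      rw [hsum ⟨_, hW _ (b i).2⟩ s]
      simp [hA]
    rw [h2]
    exact h1
  have hzero : f = fun _ => 0 := by
    refine ODE_solution_unique_univ (v := fun _ => A) (s := fun _ => Set.univ) (K := ‖A‖₊) (t₀ := 0)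
      (fun _ => A.lipschitz.lipschitzOnWith) (fun s => ⟨hderiv s, trivial⟩)
      (fun s => ⟨by simpa using hasDerivAt_const s (0 : Fin (Module.finrank ℝ W) → ℝ), trivial⟩) ?_
    ext i
    have h1 : Ad E (φ 0) (b i : GroupLieAlgebra 𝓘(ℝ, E) G) = b i := by
      rw [hφ.1]
      exact congrArg (fun T : E →L[ℝ] E => T (b i : GroupLieAlgebra 𝓘(ℝ, E) G)) adD_one
    simp only [hf, h1]
    exact hℓ _ (b i).2
  intro Y hY
  have := hsum ⟨Y, hY⟩ t
  simpa [hzero] using this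

/-- Differentiate the constant function `t ↦ Q(Ad(exp tX) Y, Ad(exp tX) Z)` at `0`. -/
theorem form_lie_of_Ad_invariant [T2Space G] {Q : EuclideanForm (GroupLieAlgebra 𝓘(ℝ, E) G)}
    (hQ : ∀ (a : G) (X Y : GroupLieAlgebra 𝓘(ℝ, E) G),
      Q.form (Ad E a X) (Ad E a Y) = Q.form X Y) (X Y Z : GroupLieAlgebra 𝓘(ℝ, E) G) :
    Q.form ⁅X, Y⁆ Z = -Q.form Y ⁅X, Z⁆ := by
  obtain ⟨φ, hφ⟩ := exists_isExpCurve X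
  obtain ⟨f, hf⟩ := Q.exists_orthonormal_basis
  -- The derivative of `Ad` is known only after applying a linear functional, so `Q` is split into
  -- products of functionals.
  have hexp : ∀ u v, Q.form u v = ∑ i, Q.form.flip (f i) u * Q.form.flip (f i) v := fun u v => by
    conv_lhs => rw [← f.sum_dual Q.form f hf u]
    simp [map_sum, LinearMap.sum_apply, Q.symm (f _) v]
  have h0 : ∀ Y, Ad E (φ 0) Y = Y := fun Y => by
    rw [hφ.1]
    exact congrArg (fun T : E →L[ℝ] E => T Y) adD_one
  have h1 := HasDerivAt.fun_sum (u := Finset.univ) fun i _ =>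
    (hasDerivAt_Ad_zero hφ (Q.form.flip (f i)) Y).mul (hasDerivAt_Ad_zero hφ (Q.form.flip (f i)) Z)
  have h2 : HasDerivAt (fun _ : ℝ => Q.form Y Z) 0 0 := hasDerivAt_const _ _
  have h3 := h1.unique (h2.congr_of_eventuallyEq (Eventually.of_forall fun t => by
    rw [← hQ (φ t) Y Z, hexp]; rfl))
  simp only [h0, Finset.sum_add_distrib, ← hexp] at h3
  linarith

end LieGroupChart

/-! ### Invariant metrics on the base, and the theorem -/

section

open LieGroupChart HomogeneousMetric

variable {E : Type*} [NormedAddCommGroup E] [NormedSpace ℝ E] [FiniteDimensional ℝ E]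
  {G : Type*} [TopologicalSpace G] [ChartedSpace E G] [Group G] [LieGroup 𝓘(ℝ, E) ∞ G]

theorem mem_toralSubgroup {H : Subgroup G} {𝔨 : LieSubalgebra ℝ (GroupLieAlgebra 𝓘(ℝ, E) G)}
    {X : GroupLieAlgebra 𝓘(ℝ, E) G} (hX : X ∈ 𝔨) {φ : ℝ → G} (hφ : IsExpCurve X φ) (t : ℝ) :
    φ t ∈ toralSubgroup H 𝔨 :=
  Subgroup.subset_closure (Or.inr ⟨t • X, 𝔨.smul_mem t hX, _, isExpCurve_comp_mul hφ t, by simp⟩)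

/-- An `Ad(K)`-invariant metric on `𝔫` is `ad(𝔨)`-invariant. -/
theorem IsInvariantMetric.form_lie [T2Space G] {Q : EuclideanForm (GroupLieAlgebra 𝓘(ℝ, E) G)}
    (hQ : ∀ (a : G) (X Y : GroupLieAlgebra 𝓘(ℝ, E) G),
      Q.form (Ad E a X) (Ad E a Y) = Q.form X Y)
    {H : Subgroup G} {𝔨 : LieSubalgebra ℝ (GroupLieAlgebra 𝓘(ℝ, E) G)}
    {P : Module.End ℝ (basePart Q 𝔨)}
    (hP : IsInvariantMetric Q (toralSubgroup H 𝔨) (basePart Q 𝔨) P)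
    (X : GroupLieAlgebra 𝓘(ℝ, E) G) (hX : X ∈ 𝔨) (Y Z : basePart Q 𝔨) :
    Q.form ⁅X, (Y : GroupLieAlgebra 𝓘(ℝ, E) G)⁆ (P Z) =
      -Q.form ⁅X, (Z : GroupLieAlgebra 𝓘(ℝ, E) G)⁆ (P Y) := by
  have had := form_lie_of_Ad_invariant hQ
  obtain ⟨φ, hφ⟩ := exists_isExpCurve X
  -- `ad_comm` applies only to vectors of `𝔫` whose image is again in `𝔫`, so `Ad(exp tX)` must
  -- first be shown to preserve `𝔫`; this follows from `[X, 𝔫] ⊆ 𝔫`.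
  have hmem : ∀ t, Ad E (φ t) Y ∈ basePart Q 𝔨 := fun t => by
    rw [EuclideanForm.mem_perp]
    intro V hV
    refine apply_Ad_eq_zero hφ (basePart Q 𝔨) (fun W hW => lie_mem_compl had hX hW)
      (Q.form.flip V) (fun W hW => EuclideanForm.mem_perp.1 hW V hV) t Y Y.2
  have h1 := hasDerivAt_Ad_zero hφ (Q.form.flip (P Z)) Y
  have h2 := hasDerivAt_Ad_zero hφ (Q.form.flip Z) (P Y)
  -- Both derivatives belong to the same function, since `Q(Ad Y, P Z) = Q(P Ad Y, Z) = Q(Ad P Y,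
  -- Z)` along `φ`.
  have h3 := h1.unique (h2.congr_of_eventuallyEq (Eventually.of_forall fun t => by
    have h4 := hP.ad_comm (φ t) (mem_toralSubgroup hX hφ t) Y ⟨_, hmem t⟩ rfl
    have h5 := hP.symm ⟨_, hmem t⟩ Z
    rw [h4] at h5
    exact h5.symm))
  have h6 : Q.form ⁅X, (Y : GroupLieAlgebra 𝓘(ℝ, E) G)⁆ (P Z) =
    Q.form ⁅X, (P Y : GroupLieAlgebra 𝓘(ℝ, E) G)⁆ Z := h3
  rw [h6, had, Q.symm]

-- In finite dimension every linear functional is continuous, so topological convergence implies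
-- convergence of all inner products.
omit [LieGroup 𝓘(ℝ, E) ∞ G] in
theorem EndTendsto.vecTendsto {Q : EuclideanForm (GroupLieAlgebra 𝓘(ℝ, E) G)}
    {W : Submodule ℝ (GroupLieAlgebra 𝓘(ℝ, E) G)} {P : ℕ → Module.End ℝ W} {P' : Module.End ℝ W}
    (h : EndTendsto P P') (X : W) : (Q.restrict W).VecTendsto (fun n => P n X) (P' X) := fun Z => by
  obtain ⟨m, hm⟩ := exists_continuousLinearMap (Q.form.flip (Z : GroupLieAlgebra 𝓘(ℝ, E) G))
  have hm' : Continuous fun x : GroupLieAlgebra 𝓘(ℝ, E) G => Q.form x Z :=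
    m.continuous.congr hm
  have hc : Continuous fun x : W => Q.form (x : GroupLieAlgebra 𝓘(ℝ, E) G) Z :=
    hm'.comp continuous_subtype_val
  exact (hc.tendsto _).comp (h X)

end

end

theorem mainTheorem5
    {E : Type*} [NormedAddCommGroup E] [NormedSpace ℝ E] [FiniteDimensional ℝ E]
    {G : Type*} [TopologicalSpace G] [ChartedSpace E G] [Group G] [LieGroup 𝓘(ℝ, E) ∞ G]
    [T2Space G] [CompactSpace G]
    (H : Subgroup G) (hH : IsClosed (H : Set G))
    (Q : EuclideanForm (GroupLieAlgebra 𝓘(ℝ, E) G))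
    (hQ : ∀ (a : G) (X Y : GroupLieAlgebra 𝓘(ℝ, E) G),
      Q.form (Ad E a X) (Ad E a Y) = Q.form X Y)
    (𝔨 : LieSubalgebra ℝ (GroupLieAlgebra 𝓘(ℝ, E) G)) (h𝔨 : IsToralSubalgebra H 𝔨)
    (P : ℕ → Module.End ℝ (totalSpace Q H)) (hP : ∀ n, IsSubmersionMetric Q H 𝔨 (P n))
    (Pinf : Module.End ℝ (basePart Q 𝔨))
    (hPinf : IsInvariantMetric Q (toralSubgroup H 𝔨) (basePart Q 𝔨) Pinf)
    (hfibre : EndTendsto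
      (fun n => Q.restrictEnd (totalSpace Q H) (fibrePart Q H 𝔨) (P n)) 0)
    (hbase : EndTendsto
      (fun n => Q.restrictEnd (totalSpace Q H) (basePart Q 𝔨) (P n)) Pinf) :
    Tendsto (fun n => HomogeneousMetric.scal Q (subgroupLieAlgebra E H) (P n)) atTop
      (𝓝 (HomogeneousMetric.scal Q 𝔨 Pinf)) :=
  HomogeneousMetric.tendsto_scal_of_collapse
    (LieGroupChart.form_lie_of_Ad_invariant hQ) h𝔨.lt.le h𝔨.lie_mem
    (fun n => (hP n).metric.symm) (fun n => (hP n).metric.pos) hPinf.pos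
    (fun n => Q.coe_restrictEnd HomogeneousMetric.vertical_le (hP n).fibre_mem)
    (fun n => Q.coe_restrictEnd (HomogeneousMetric.compl_le h𝔨.lt.le) (hP n).base_mem)
    (fun n => (hP n).base_metric.form_lie hQ)
    hfibre.vecTendsto hbase.vecTendsto
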